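/- Let $\alpha>0$ and $L>0$ be fixed. For a symmetric real $p\times p$ matrix write $\Sigma=[\sigma_{ij}]$, and for $\varphi>0$ let $$Q(\alpha,L,\varphi)=\Big\{\Sigma\ \text{nonnegative definite}:\ \sigma_{ii}=1\ \text{for all } i,\ \ \frac1p\sum_{1\le i<j\le p}\sigma_{ij}^2|i-j|^{2\alpha}\le L,\ \ \frac1p\sum_{1\le i<j\le p}\sigma_{ij}^2\ge\varphi^2\Big\}.$$ One observes $n$ independent random vectors $X_1,\dots,X_n$ with law $\mathcal N_p(0,\Sigma)$ and denotes by $\mathbb E_\Sigma$ the expectation under their joint law. A test $\Delta$ is a measurable function of $(X_1,\dots,X_n)$ with values in $[0,1]$. The minimax total error probability for testing $\Sigma=I$ against $\Sigma\in Q(\alpha,L,\varphi)$ is $$\gamma=\inf_{\Delta}\Big(\mathbb E_I(\Delta)+\sup_{\Sigma\in Q(\alpha,L,\varphi)}\mathbb E_\Sigma(1-\Delta)\Big),$$ where the infimum is over all tests. Put $$b(\varphi)=C(\alpha,L)^{1/2}\varphi^{2+\frac1{2\alpha}},\qquad C(\alpha,L)=\frac{2\alpha+1}{(4\alpha+1)^{1+1/(2\alpha)}}\,L^{-\frac1{2\alpha}}.$$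 Theorem. Let $n\to\infty$ and $p\to\infty$ along a sequence, and let $\varphi=\varphi_{n,p}>0$. Assume that either $\alpha>3/2$, or $\alpha>5/8$ and $np\,\varphi^{6-2/\alpha}\to0$. If $$\varphi\to0,\qquad p\,\varphi^{1/\alpha}\to\infty,\qquad n^2p\,b^2(\varphi)\to0,$$ then $\gamma\to1$. -/

import Mathlib

open Filter Topology MeasureTheory ProbabilityTheory

noncomputable section

namespace CovTest

/-- The ellipsoid class `F(α, L)` in dimension `p`: nonnegative definite real `p × p` matrices with
unit diagonal such that `(1/p) ∑_{i<j} σ_{ij}² |i-j|^{2α} ≤ L`. -/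
def classF (p : ℕ) (α L : ℝ) : Set (Matrix (Fin p) (Fin p) ℝ) :=
  {S | S.PosSemidef ∧ (∀ i, S i i = 1) ∧
    (1 / (p : ℝ)) * ∑ i : Fin p, ∑ j ∈ Finset.Ioi i,
      S i j ^ 2 * |(i : ℝ) - (j : ℝ)| ^ (2 * α) ≤ L}

/-- The alternative `Q(α, L, φ)`: the members of `F(α, L)` with
`(1/p) ∑_{i<j} σ_{ij}² ≥ φ²`. -/
def classQ (p : ℕ) (α L φ : ℝ) : Set (Matrix (Fin p) (Fin p) ℝ) :=
  {S | S ∈ classF p α L ∧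
    φ ^ 2 ≤ (1 / (p : ℝ)) * ∑ i : Fin p, ∑ j ∈ Finset.Ioi i, S i j ^ 2}

/-- The sample space of `n` observations in `ℝ^p`. -/
abbrev Sample (n p : ℕ) : Type := Fin n → EuclideanSpace ℝ (Fin p)

/-- The joint law of `n` independent `N_p(0, S)` vectors. -/
def sampleLaw (n p : ℕ) (S : Matrix (Fin p) (Fin p) ℝ) : Measure (Sample n p) :=
  Measure.pi fun _ : Fin n => multivariateGaussian (0 : EuclideanSpace ℝ (Fin p)) S

/-- Test procedures: measurable functions of the observations with values in `[0, 1]`. -/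
def IsTest {n p : ℕ} (Δ : Sample n p → ℝ) : Prop :=
  Measurable Δ ∧ ∀ x, Δ x ∈ Set.Icc (0 : ℝ) 1

/-- The type I error probability `η(Δ) = E_I(Δ)`. -/
def typeI {n p : ℕ} (Δ : Sample n p → ℝ) : ℝ :=
  ∫ x, Δ x ∂(sampleLaw n p 1)

/-- The maximal type II error probability `β(Δ, Q) = sup_{S ∈ Q} E_S(1 - Δ)`. -/
def typeII {n p : ℕ} (Δ : Sample n p → ℝ) (Q : Set (Matrix (Fin p) (Fin p) ℝ)) : ℝ :=
  ⨆ S : Q, ∫ x, (1 - Δ x) ∂(sampleLaw n p S.1)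

/-- The total error probability `γ(Δ, Q) = η(Δ) + β(Δ, Q)`. -/
def totalError {n p : ℕ} (Δ : Sample n p → ℝ) (Q : Set (Matrix (Fin p) (Fin p) ℝ)) : ℝ :=
  typeI Δ + typeII Δ Q

/-- The minimax total error probability `γ(Q) = inf_Δ γ(Δ, Q)` over all test procedures. -/
def minimaxError (n p : ℕ) (Q : Set (Matrix (Fin p) (Fin p) ℝ)) : ℝ :=
  ⨅ Δ : {Δ : Sample n p → ℝ // IsTest Δ}, totalError Δ.1 Q

/-- The constant `C(α, L) = (2α+1) (4α+1)^{-(1+1/(2α))} L^{-1/(2α)}`. -/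
def constC (α L : ℝ) : ℝ :=
  (2 * α + 1) / (4 * α + 1) ^ (1 + 1 / (2 * α)) * L ^ (-(1 / (2 * α)))

/-- `b(φ) = C(α, L)^{1/2} φ^{2+1/(2α)}`. -/
def bFun (α L φ : ℝ) : ℝ :=
  constC α L ^ ((1 : ℝ) / 2) * φ ^ (2 + 1 / (2 * α))

end CovTest

end

/-! The minimax error is at most `1` because of the constant test, so only the lower bound matters.
Replace the worst case over the alternative by an average over a finite set of matrices: split the
coordinates into consecutive blocks of length `T ≍ φ ^ (-1/α)`, and on each block put the rank one
spike `(1 - ε) I + ε w wᵀ` with a sign vector `w` and `ε² = 8 φ² / T`. For this choice of `T` and `ε`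
the matrices lie in the alternative (`one_add_spike_mem_classQ`), and since `α > 1/2` the
perturbation is a contraction: `ε T → 0`.

The total error of any test is at least `1 - δ` as soon as the likelihood ratio of the mixture over
uniform `w` has second moment at most `1 + δ²` (`one_sub_le_minimaxError`). For Gaussian laws with
covariances `1 + A` and `1 + A'` the corresponding integral is `det (1 - A A') ^ (-1/2)` for each of
the `n` observations (`integral_likelihoodRatio_mul`). For two block spiked matrices the determinant is a product over
the blocks of an explicit function of the inner product `s` of the two sign vectors
(`det_one_sub_spike_mul`), whose logarithm is `-ε² (s² - T)` up to terms of order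
`ε⁴ (T² + s⁴)`. Under the uniform prior `s` is a sum of `T` independent signs, so `s² - T` is
centred and `s² / T` has a bounded exponential moment; a block contributes a factor
`1 + O((n ε² T)²)` (`average_exp_block_le`), hence the second moment is at most
`exp (O(n² φ⁴ p / T))`, and `n² φ⁴ p / T ≍ n² p b²(φ) → 0`.

Because the spikes have rank one, the determinant is explicit and its large deviations are those of
the scalar `s`: no bound for the norm of a random matrix enters. -/

open scoped Matrix MatrixOrder ENNReal

noncomputable section

namespace CovTest

open Matrix (toEuclideanLin)

/-! ### Densities on product spaces and of Gaussian vectors -/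

section

lemma pi_withDensity {ι : Type*} [Fintype ι] {E : ι → Type*} [∀ i, MeasurableSpace (E i)]
    (μ : ∀ i, Measure (E i)) [∀ i, SigmaFinite (μ i)] (f : ∀ i, E i → ℝ)
    (hf0 : ∀ i x, 0 ≤ f i x) (hfi : ∀ i, Integrable (f i) (μ i)) :
    Measure.pi (fun i => (μ i).withDensity fun x => ENNReal.ofReal (f i x)) =
      (Measure.pi μ).withDensity fun x => ENNReal.ofReal (∏ i, f i (x i)) := by
  have (i : ι) : IsFiniteMeasure ((μ i).withDensity fun x => ENNReal.ofReal (f i x)) :=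
    isFiniteMeasure_withDensity_ofReal (hfi i).hasFiniteIntegral
  refine (Measure.pi_eq fun s hs => ?_)
  rw [withDensity_apply _ (MeasurableSet.univ_pi hs), Measure.restrict_pi_pi,
    ← ofReal_integral_eq_lintegral_ofReal]
  · rw [integral_fintype_prod_eq_prod, ENNReal.ofReal_prod_of_nonneg]
    · refine Finset.prod_congr rfl fun i _ => ?_
      rw [withDensity_apply _ (hs i)]
      exact ofReal_integral_eq_lintegral_ofReal (hfi i).restrict (ae_of_all _ (hf0 i))
    · exact fun i _ => integral_nonneg (hf0 i)
  · exact Integrable.fintype_prod_dep (f := f) (μ := fun i => (μ i).restrict (s i))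
      fun i => (hfi i).restrict
  · exact ae_of_all _ fun x => Finset.prod_nonneg fun i _ => hf0 i _

variable {ι : Type*} [Fintype ι] [DecidableEq ι]

/-- The Lebesgue density of the centred Gaussian law with covariance `S`. It has this meaning only
for positive definite `S`; otherwise `S⁻¹` or the square root may take a junk value. -/
def gaussianDensity (S : Matrix ι ι ℝ) (x : EuclideanSpace ℝ ι) : ℝ :=
  (√(2 * Real.pi))⁻¹ ^ Fintype.card ι * (√S.det)⁻¹ * Real.exp (-(x ⬝ᵥ S⁻¹ *ᵥ x) / 2)

lemma gaussianDensity_pos {S : Matrix ι ι ℝ} (hS : 0 < S.det) (x : EuclideanSpace ℝ ι) :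
    0 < gaussianDensity S x := by
  unfold gaussianDensity
  positivity

@[fun_prop]
lemma continuous_gaussianDensity (S : Matrix ι ι ℝ) : Continuous (gaussianDensity S) := by
  unfold gaussianDensity
  fun_prop

lemma stdGaussian_eq_withDensity :
    stdGaussian (EuclideanSpace ℝ ι) =
      volume.withDensity fun x => ENNReal.ofReal (gaussianDensity 1 x) := by
  rw [← map_pi_eq_stdGaussian]
  have h1 : (gaussianReal 0 1) = (volume : Measure ℝ).withDensity
      fun x => ENNReal.ofReal (gaussianPDFReal 0 1 x) :=
    gaussianReal_of_var_ne_zero 0 one_ne_zero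
  simp_rw [h1]
  rw [pi_withDensity _ _ (fun _ => gaussianPDFReal_nonneg 0 1)
    (fun _ => integrable_gaussianPDFReal 0 1)]
  have hvp := PiLp.volume_preserving_toLp ι
  ext s hs
  have hm : Measurable fun x : EuclideanSpace ℝ ι => ENNReal.ofReal (gaussianDensity 1 x) := by
    fun_prop
  rw [Measure.map_apply hvp.measurable hs, withDensity_apply _ (hvp.measurable hs),
    withDensity_apply _ hs, ← hvp.map_eq, setLIntegral_map hs hm hvp.measurable]
  refine lintegral_congr fun x => ?_
  congr 1
  simp only [gaussianPDFReal, gaussianDensity, Finset.prod_mul_distrib, ← Real.exp_sum]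
  simp [dotProduct, pow_two, ← Finset.sum_div]

lemma det_toEuclideanLin (R : Matrix ι ι ℝ) : LinearMap.det (toEuclideanLin R) = R.det := by
  rw [Matrix.toEuclideanLin_eq_toLin_orthonormal, LinearMap.det_toLin]

lemma multivariateGaussian_eq_withDensity_volume {S : Matrix ι ι ℝ} (hS : S.PosDef) :
    multivariateGaussian 0 S = volume.withDensity fun x => ENNReal.ofReal (gaussianDensity S x) := by
  set R := CFC.sqrt S with hR
  have hRR : R * R = S := CFC.sqrt_mul_sqrt_self _ hS.posSemidef.nonneg
  have hRs : R.PosSemidef := by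
    exact Matrix.nonneg_iff_posSemidef.1 (CFC.sqrt_nonneg S)
  have hdet : R.det * R.det = S.det := by rw [← Matrix.det_mul, hRR]
  have hR0 : 0 ≤ R.det := hRs.det_nonneg
  have hSd := hS.det_pos
  have hRd : 0 < R.det := by
    rcases hR0.eq_or_lt with h | h
    · rw [← h] at hdet; simp at hdet; linarith
    · exact h
  have hRu : IsUnit R.det := hRd.ne'.isUnit
  have hsq : √S.det = R.det := by rw [← hdet, Real.sqrt_mul_self hR0]
  have hinv : Rᵀ * S⁻¹ * R = 1 := by
    have : Rᵀ = R := by simpa [Matrix.IsSymm] using hRs.1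
    rw [this, ← hRR, Matrix.mul_inv_rev, ← mul_assoc, Matrix.mul_nonsing_inv _ hRu, one_mul,
      Matrix.nonsing_inv_mul _ hRu]
  have hmR : Measurable (toEuclideanLin R) :=
    (LinearMap.continuous_of_finiteDimensional _).measurable
  have hdl : LinearMap.det (toEuclideanLin R) ≠ 0 := by
    rw [det_toEuclideanLin]; exact hRd.ne'
  -- change of variables for the linear map `R = √S`
  have hvol : (volume : Measure (EuclideanSpace ℝ ι)) =
      ENNReal.ofReal R.det • Measure.map (toEuclideanLin R) volume := by
    rw [Measure.map_linearMap_addHaar_eq_smul_addHaar _ hdl, det_toEuclideanLin, smul_smul,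
      ← ENNReal.ofReal_mul hR0, abs_of_pos (inv_pos.2 hRd), mul_inv_cancel₀ hRd.ne']
    simp
  have hmg : Measurable fun x : EuclideanSpace ℝ ι => ENNReal.ofReal (gaussianDensity S x) := by
    fun_prop
  have hmap : multivariateGaussian 0 S =
      (stdGaussian (EuclideanSpace ℝ ι)).map (toEuclideanLin R) := by
    unfold multivariateGaussian
    congr 1
    ext x
    simp [hR]
  rw [hmap, stdGaussian_eq_withDensity]
  ext s hs
  have hmc : Measurable fun x => ENNReal.ofReal (gaussianDensity S (toEuclideanLin R x)) :=
    hmg.comp hmR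
  have hR : ∫⁻ x in s, ENNReal.ofReal (gaussianDensity S x) = ENNReal.ofReal R.det *
      ∫⁻ x in toEuclideanLin R ⁻¹' s, ENNReal.ofReal (gaussianDensity S (toEuclideanLin R x)) := by
    conv_lhs => rw [hvol]
    rw [Measure.restrict_smul, lintegral_smul_measure, setLIntegral_map hs hmg hmR, smul_eq_mul]
  rw [Measure.map_apply hmR hs, withDensity_apply _ (hmR hs), withDensity_apply _ hs, hR,
    ← lintegral_const_mul _ hmc]
  refine lintegral_congr fun x => ?_
  rw [← ENNReal.ofReal_mul hR0]
  congr 1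
  have hq : (toEuclideanLin R x) ⬝ᵥ S⁻¹ *ᵥ (toEuclideanLin R x) = x ⬝ᵥ x := by
    have h1 : (toEuclideanLin R x).ofLp = R *ᵥ x.ofLp := rfl
    rw [h1, Matrix.mulVec_mulVec, Matrix.dotProduct_mulVec, ← Matrix.mulVec_transpose,
      Matrix.mulVec_mulVec, dotProduct_comm, Matrix.transpose_mul, Matrix.transpose_nonsing_inv]
    have hSt : Sᵀ = S := by simpa [Matrix.IsSymm] using hS.1
    rw [hSt, hinv, Matrix.one_mulVec]
  unfold gaussianDensity
  rw [hq, hsq]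
  simp
  field_simp

/-- The density of `N(0, S)` with respect to the standard Gaussian law. -/
def likelihoodRatio (S : Matrix ι ι ℝ) (x : EuclideanSpace ℝ ι) : ℝ :=
  gaussianDensity S x / gaussianDensity 1 x

lemma gaussianDensity_one_pos (x : EuclideanSpace ℝ ι) : 0 < gaussianDensity 1 x :=
  gaussianDensity_pos (by simp) x

lemma likelihoodRatio_nonneg {S : Matrix ι ι ℝ} (hS : 0 < S.det) (x : EuclideanSpace ℝ ι) :
    0 ≤ likelihoodRatio S x :=
  (div_pos (gaussianDensity_pos hS x) (gaussianDensity_one_pos x)).le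

@[fun_prop]
lemma continuous_likelihoodRatio (S : Matrix ι ι ℝ) : Continuous (likelihoodRatio S) :=
  (continuous_gaussianDensity S).div (continuous_gaussianDensity 1)
    fun x => (gaussianDensity_one_pos x).ne'

lemma multivariateGaussian_eq_withDensity {S : Matrix ι ι ℝ} (hS : S.PosDef) :
    multivariateGaussian 0 S =
      (stdGaussian (EuclideanSpace ℝ ι)).withDensity
        fun x => ENNReal.ofReal (likelihoodRatio S x) := by
  rw [multivariateGaussian_eq_withDensity_volume hS, stdGaussian_eq_withDensity,
    ← withDensity_mul _ (by fun_prop) (by fun_prop)]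
  congr 1
  ext x
  rw [Pi.mul_apply, ← ENNReal.ofReal_mul (gaussianDensity_one_pos x).le, likelihoodRatio,
    mul_div_cancel₀ _ (gaussianDensity_one_pos x).ne']

lemma integrable_integral_gaussianDensity {S : Matrix ι ι ℝ} (hS : S.PosDef) :
    Integrable (gaussianDensity S) ∧ ∫ x, gaussianDensity S x = 1 := by
  have h : ∫⁻ x, ENNReal.ofReal (gaussianDensity S x) = 1 := by
    have := measure_univ (μ := multivariateGaussian (0 : EuclideanSpace ℝ ι) S)
    rwa [multivariateGaussian_eq_withDensity_volume hS, withDensity_apply _ .univ,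
      Measure.restrict_univ] at this
  have h0 : 0 ≤ᵐ[volume] gaussianDensity S :=
    ae_of_all _ fun x => (gaussianDensity_pos hS.det_pos x).le
  have hm : AEStronglyMeasurable (gaussianDensity S) volume :=
    (continuous_gaussianDensity S).aestronglyMeasurable
  refine ⟨(lintegral_ofReal_ne_top_iff_integrable hm h0).1 (by simp [h]), ?_⟩
  rw [integral_eq_lintegral_of_nonneg_ae h0 hm, h, ENNReal.toReal_one]

/-- Chi-square type integral of two Gaussian likelihood ratios: if the quadratic form of
`S⁻¹ + S'⁻¹ - 1` is positive, then `f_S f_{S'} f_1⁻¹` is, up to a constant, the density of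
the Gaussian law with that precision matrix. -/
lemma integral_likelihoodRatio_mul {A A' : Matrix ι ι ℝ} (hS : (1 + A).PosDef)
    (hS' : (1 + A').PosDef) (hM : ((1 + A)⁻¹ + (1 + A')⁻¹ - 1).PosDef) :
    Integrable (fun x => likelihoodRatio (1 + A) x * likelihoodRatio (1 + A') x)
        (stdGaussian (EuclideanSpace ℝ ι)) ∧
      ∫ x, likelihoodRatio (1 + A) x * likelihoodRatio (1 + A') x
        ∂(stdGaussian (EuclideanSpace ℝ ι)) = (√(1 - A * A').det)⁻¹ := by
  set M := (1 + A)⁻¹ + (1 + A')⁻¹ - 1 with hMdef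
  set C := (√(1 - A * A').det)⁻¹ with hC
  have hd := hS.det_pos
  have hd' := hS'.det_pos
  have hdM := hM.det_pos
  have hdet : (1 - A * A').det = (1 + A).det * M.det * (1 + A').det := by
    rw [← Matrix.det_mul, ← Matrix.det_mul]
    congr 1
    have h : (1 + A) * M * (1 + A') = (1 + A) * (1 + A)⁻¹ * (1 + A') +
        (1 + A) * ((1 + A')⁻¹ * (1 + A')) - (1 + A) * (1 + A') := by
      rw [hMdef]
      generalize (1 + A)⁻¹ = P
      generalize (1 + A')⁻¹ = P'
      noncomm_ring
    rw [h, Matrix.mul_nonsing_inv _ hd.ne'.isUnit, Matrix.nonsing_inv_mul _ hd'.ne'.isUnit]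
    noncomm_ring
  have hMi : (M⁻¹).PosDef := hM.inv
  have hMM : M⁻¹⁻¹ = M := Matrix.nonsing_inv_nonsing_inv _ hdM.ne'.isUnit
  have key : ∀ x, gaussianDensity 1 x * (likelihoodRatio (1 + A) x * likelihoodRatio (1 + A') x) =
      C * gaussianDensity M⁻¹ x := by
    intro x
    have h1 : gaussianDensity 1 x * (likelihoodRatio (1 + A) x * likelihoodRatio (1 + A') x) =
        gaussianDensity (1 + A) x * gaussianDensity (1 + A') x / gaussianDensity 1 x := by
      have := (gaussianDensity_one_pos x).ne'
      unfold likelihoodRatio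
      field_simp
    rw [h1, div_eq_iff (gaussianDensity_one_pos x).ne', hC, hdet]
    have hq : x ⬝ᵥ M *ᵥ x = x ⬝ᵥ (1 + A)⁻¹ *ᵥ x + x ⬝ᵥ (1 + A')⁻¹ *ᵥ x - x ⬝ᵥ x := by
      rw [hMdef, Matrix.sub_mulVec, Matrix.add_mulVec, dotProduct_sub, dotProduct_add,
        Matrix.one_mulVec]
    have he : Real.exp (-(x ⬝ᵥ (1 + A)⁻¹ *ᵥ x) / 2) * Real.exp (-(x ⬝ᵥ (1 + A')⁻¹ *ᵥ x) / 2) =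
        Real.exp (-(x ⬝ᵥ M *ᵥ x) / 2) * Real.exp (-(x ⬝ᵥ x) / 2) := by
      rw [← Real.exp_add, ← Real.exp_add, hq]
      ring_nf
    unfold gaussianDensity
    rw [hMM, Real.sqrt_mul (mul_pos hd hdM).le, Real.sqrt_mul hd.le, Matrix.det_nonsing_inv]
    simp only [Ring.inverse_eq_inv', Real.sqrt_inv, inv_inv, mul_inv, inv_one, Matrix.one_mulVec,
      Matrix.det_one, Real.sqrt_one, mul_one]
    have hM' : √M.det ≠ 0 := (Real.sqrt_pos.2 hdM).ne'
    set a := Real.exp (-(x ⬝ᵥ (1 + A)⁻¹ *ᵥ x) / 2)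
    set b := Real.exp (-(x ⬝ᵥ (1 + A')⁻¹ *ᵥ x) / 2)
    set c := (√(2 * Real.pi))⁻¹ ^ Fintype.card ι
    calc _ = c * c * (√(1 + A).det)⁻¹ * (√(1 + A').det)⁻¹ * (a * b) := by ring
      _ = _ := by
        rw [he]
        field_simp
  obtain ⟨hi, hI⟩ := integrable_integral_gaussianDensity hMi
  have hfm : Measurable fun x : EuclideanSpace ℝ ι => ENNReal.ofReal (gaussianDensity 1 x) := by
    fun_prop
  have hft : ∀ᵐ x : EuclideanSpace ℝ ι, ENNReal.ofReal (gaussianDensity 1 x) < ∞ :=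
    ae_of_all _ fun _ => ENNReal.ofReal_lt_top
  have key' : (fun x => (ENNReal.ofReal (gaussianDensity 1 x)).toReal •
      (likelihoodRatio (1 + A) x * likelihoodRatio (1 + A') x)) =
      fun x => C * gaussianDensity M⁻¹ x := by
    ext x
    rw [ENNReal.toReal_ofReal (gaussianDensity_one_pos x).le, smul_eq_mul, key]
  rw [stdGaussian_eq_withDensity]
  constructor
  · rw [integrable_withDensity_iff_integrable_smul' hfm hft, key']
    exact hi.const_mul C
  · rw [integral_withDensity_eq_integral_toReal_smul hfm hft, key', integral_const_mul, hI, mul_one]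

end

/-! ### Bayesian lower bound for the minimax error -/

section

/-- Second moment method: if the mixture `g = |U|⁻¹ ∑ F u` of densities satisfies
`∫ g² ≤ 1 + δ²`, then no `ψ` with values in `[0, 1]` distinguishes `P` from the mixture up to an
error sum smaller than `1 - δ`. -/
lemma one_sub_le_integral_add_average {Ω : Type*} [MeasurableSpace Ω] (P : Measure Ω)
    [IsProbabilityMeasure P] {U : Type*} [Fintype U] [Nonempty U] (F : U → Ω → ℝ)
    (hFm : ∀ u, AEStronglyMeasurable (F u) P) (hF1 : ∀ u, ∫ x, F u x ∂P = 1)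
    (hFF : ∀ u v, Integrable (fun x => F u x * F v x) P) {δ : ℝ} (hδ : 0 < δ)
    (hchi : ((Fintype.card U : ℝ)⁻¹) ^ 2 * ∑ u, ∑ v, ∫ x, F u x * F v x ∂P ≤ 1 + δ ^ 2)
    {ψ : Ω → ℝ} (hψm : Measurable ψ) (hψ : ∀ x, ψ x ∈ Set.Icc (0 : ℝ) 1) :
    1 - δ ≤ ∫ x, ψ x ∂P + (Fintype.card U : ℝ)⁻¹ * ∑ u, ∫ x, F u x * (1 - ψ x) ∂P := by
  set c : ℝ := (Fintype.card U : ℝ)⁻¹ with hc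
  have hc1 : c * Fintype.card U = 1 := inv_mul_cancel₀ (by simp)
  have hFi : ∀ u, Integrable (F u) P := fun u =>
    ((memLp_two_iff_integrable_sq (hFm u)).2 (by simpa [pow_two] using hFF u u)).integrable
      (by norm_num)
  have hψi : Integrable ψ P := Integrable.of_bound hψm.aestronglyMeasurable 1
    (ae_of_all _ fun x => by rw [Real.norm_eq_abs, abs_le]; constructor <;> linarith [(hψ x).1, (hψ x).2])
  have hFψ : ∀ u, Integrable (fun x => F u x * (1 - ψ x)) P := fun u =>
    (hFi u).mul_bdd (c := 1) (by fun_prop) (ae_of_all _ fun x => by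
      rw [Real.norm_eq_abs, abs_le]; constructor <;> linarith [(hψ x).1, (hψ x).2])
  set g : Ω → ℝ := fun x => c * ∑ u, F u x with hg
  have hgi : Integrable g P := (integrable_finsetSum _ fun u _ => hFi u).const_mul c
  have hg1 : ∫ x, g x ∂P = 1 := by
    rw [hg, integral_const_mul, integral_finsetSum _ fun u _ => hFi u]
    simp [hF1, hc1]
  have hgg : ∀ x, g x ^ 2 = c ^ 2 * ∑ u, ∑ v, F u x * F v x := fun x => by
    rw [hg]
    simp only
    rw [mul_pow, pow_two (∑ u, F u x), Finset.sum_mul_sum]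
  have hggi : Integrable (fun x => g x ^ 2) P := by
    simp_rw [hgg]
    exact (integrable_finsetSum _ fun u _ => integrable_finsetSum _ fun v _ => hFF u v).const_mul _
  have hgg1 : ∫ x, g x ^ 2 ∂P ≤ 1 + δ ^ 2 := by
    simp_rw [hgg]
    rw [integral_const_mul, integral_finsetSum _ fun u _ =>
      integrable_finsetSum _ fun v _ => hFF u v]
    simp_rw [integral_finsetSum _ fun v _ => hFF _ v]
    exact hchi
  have hgψ : ∀ x, g x * (1 - ψ x) = c * ∑ u, F u x * (1 - ψ x) := fun x => by
    rw [hg]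
    simp only
    rw [mul_assoc, Finset.sum_mul]
  have hgψi : Integrable (fun x => g x * (1 - ψ x)) P := by
    simp_rw [hgψ]
    exact (integrable_finsetSum _ fun u _ => hFψ u).const_mul _
  have hsum : c * ∑ u, ∫ x, F u x * (1 - ψ x) ∂P = ∫ x, g x * (1 - ψ x) ∂P := by
    simp_rw [hgψ]
    rw [integral_const_mul, integral_finsetSum _ fun u _ => hFψ u]
  rw [hsum, ← integral_add hψi hgψi]
  have hi1 : Integrable (fun x => g x ^ 2 - 2 * g x) P := hggi.sub (hgi.const_mul 2)
  have hi2 : Integrable (fun x => g x ^ 2 - 2 * g x + 1) P := hi1.add (integrable_const 1)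
  -- `|g - 1|` is bounded by `δ / 2 + (g - 1)² / (2 δ)`
  have hlow : ∫ x, (1 - δ / 2 - (2 * δ)⁻¹ * (g x ^ 2 - 2 * g x + 1)) ∂P ≤
      ∫ x, (ψ x + g x * (1 - ψ x)) ∂P := by
    refine integral_mono ((integrable_const _).sub (hi2.const_mul _)) (hψi.add hgψi) fun x => ?_
    have h0 := (hψ x).1
    have h1 := (hψ x).2
    have hsq : (2 * δ)⁻¹ * (g x ^ 2 - 2 * g x + 1) = ((g x - 1) / δ) ^ 2 * (δ / 2) := by
      field_simp
      ring
    have hab : |g x - 1| ≤ δ / 2 + ((g x - 1) / δ) ^ 2 * (δ / 2) := by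
      have h2 : |g x - 1| = |(g x - 1) / δ| * δ := by
        rw [abs_div, abs_of_pos hδ]; field_simp
      rw [h2, ← sq_abs ((g x - 1) / δ)]
      nlinarith [mul_nonneg hδ.le (sq_nonneg (|(g x - 1) / δ| - 1))]
    have h3 : -|g x - 1| ≤ (g x - 1) * (1 - ψ x) := by
      have := neg_abs_le ((g x - 1) * (1 - ψ x))
      rw [abs_mul, abs_of_nonneg (sub_nonneg.2 h1)] at this
      nlinarith [abs_nonneg (g x - 1)]
    simp only
    rw [hsq]
    linarith
  refine le_trans ?_ hlow
  rw [integral_sub (integrable_const _) (hi2.const_mul _),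
    integral_const_mul, integral_add hi1 (integrable_const _),
    integral_sub hggi (hgi.const_mul 2), integral_const_mul, hg1]
  simp only [integral_const, probReal_univ, smul_eq_mul, one_mul, mul_one]
  have : (2 * δ)⁻¹ * (∫ x, g x ^ 2 ∂P - 2 + 1) ≤ (2 * δ)⁻¹ * δ ^ 2 :=
    mul_le_mul_of_nonneg_left (by linarith) (by positivity)
  have h4 : (2 * δ)⁻¹ * δ ^ 2 = δ / 2 := by field_simp
  linarith

instance (n p : ℕ) (S : Matrix (Fin p) (Fin p) ℝ) : IsProbabilityMeasure (sampleLaw n p S) := by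
  unfold sampleLaw
  infer_instance

variable {n p : ℕ}

lemma integrable_of_isTest {Δ : Sample n p → ℝ} (hΔ : IsTest Δ) (S : Matrix (Fin p) (Fin p) ℝ) :
    Integrable Δ (sampleLaw n p S) :=
  Integrable.of_bound hΔ.1.aestronglyMeasurable 1 (ae_of_all _ fun x => by
    rw [Real.norm_eq_abs, abs_le]; constructor <;> linarith [(hΔ.2 x).1, (hΔ.2 x).2])

lemma integral_one_sub_mem_Icc {Δ : Sample n p → ℝ} (hΔ : IsTest Δ)
    (S : Matrix (Fin p) (Fin p) ℝ) :
    ∫ x, (1 - Δ x) ∂(sampleLaw n p S) ∈ Set.Icc (0 : ℝ) 1 := by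
  refine ⟨integral_nonneg fun x => sub_nonneg.2 (hΔ.2 x).2, ?_⟩
  calc _ ≤ ∫ x, (1 : ℝ) ∂(sampleLaw n p S) :=
        integral_mono ((integrable_const _).sub (integrable_of_isTest hΔ S)) (integrable_const _)
          fun x => by simpa using (hΔ.2 x).1
    _ = 1 := by simp

lemma totalError_nonneg {Δ : Sample n p → ℝ} (hΔ : IsTest Δ)
    (Q : Set (Matrix (Fin p) (Fin p) ℝ)) : 0 ≤ totalError Δ Q :=
  add_nonneg (integral_nonneg fun x => (hΔ.2 x).1)
    (Real.iSup_nonneg fun S => (integral_one_sub_mem_Icc hΔ S.1).1)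

/-- The trivial test `Δ = 1` has total error at most `1`. -/
lemma minimaxError_le_one (Q : Set (Matrix (Fin p) (Fin p) ℝ)) : minimaxError n p Q ≤ 1 := by
  have h1 : IsTest (fun _ : Sample n p => (1 : ℝ)) := ⟨measurable_const, fun x => by simp⟩
  have hb : BddBelow (Set.range fun Δ : {Δ : Sample n p → ℝ // IsTest Δ} => totalError Δ.1 Q) :=
    ⟨0, by rintro _ ⟨Δ, rfl⟩; exact totalError_nonneg Δ.2 Q⟩
  refine (ciInf_le hb ⟨_, h1⟩).trans ?_
  simp [totalError, typeI, typeII]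

/-- Reduction to a finite prior: a family `1 + A u` of covariance matrices in `Q`, under the uniform
prior on `u`, bounds the minimax error from below through the second moment of the mixture
likelihood ratio, which is an average of determinants. -/
lemma one_sub_le_minimaxError {U : Type*} [Fintype U] [Nonempty U]
    (A : U → Matrix (Fin p) (Fin p) ℝ) {Q : Set (Matrix (Fin p) (Fin p) ℝ)}
    (hQ : ∀ u, 1 + A u ∈ Q) (hpos : ∀ u, (1 + A u).PosDef)
    (hM : ∀ u v, ((1 + A u)⁻¹ + (1 + A v)⁻¹ - 1).PosDef) {δ : ℝ} (hδ : 0 < δ)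
    (hchi : ((Fintype.card U : ℝ)⁻¹) ^ 2 * ∑ u, ∑ v, (√(1 - A u * A v).det)⁻¹ ^ n ≤ 1 + δ ^ 2) :
    1 - δ ≤ minimaxError n p Q := by
  have : Nonempty {Δ : Sample n p → ℝ // IsTest Δ} :=
    ⟨fun _ => 1, measurable_const, fun x => by simp⟩
  refine le_ciInf fun ⟨Δ, hΔ⟩ => ?_
  set P := sampleLaw n p 1 with hP
  have hPpi : P = Measure.pi fun _ : Fin n => stdGaussian (EuclideanSpace ℝ (Fin p)) := by
    simp [hP, sampleLaw]
  set F : U → Sample n p → ℝ := fun u x => ∏ i, likelihoodRatio (1 + A u) (x i) with hF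
  have hF0 : ∀ u x, 0 ≤ F u x := fun u x =>
    Finset.prod_nonneg fun i _ => likelihoodRatio_nonneg (hpos u).det_pos _
  have hcont : ∀ u, Continuous (F u) := fun u => by
    simp only [hF]
    fun_prop
  have hFF : ∀ u v x, F u x * F v x =
      ∏ i, likelihoodRatio (1 + A u) (x i) * likelihoodRatio (1 + A v) (x i) := fun u v x => by
    simp only [hF, Finset.prod_mul_distrib]
  have hlaw : ∀ u, sampleLaw n p (1 + A u) = P.withDensity fun x => ENNReal.ofReal (F u x) := by
    intro u
    have hi : Integrable (likelihoodRatio (1 + A u)) (stdGaussian (EuclideanSpace ℝ (Fin p))) := by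
      refine ((memLp_two_iff_integrable_sq (continuous_likelihoodRatio _).aestronglyMeasurable).2
        ?_).integrable (by norm_num)
      simpa [pow_two] using (integral_likelihoodRatio_mul (hpos u) (hpos u) (hM u u)).1
    rw [sampleLaw, multivariateGaussian_eq_withDensity (hpos u), hPpi,
      pi_withDensity _ _ (fun _ => likelihoodRatio_nonneg (hpos u).det_pos) fun _ => hi]
  have hint : ∀ u (h : Sample n p → ℝ),
      ∫ x, h x ∂(sampleLaw n p (1 + A u)) = ∫ x, F u x * h x ∂P := fun u h => by
    have hm : Measurable fun x => ENNReal.ofReal (F u x) := (hcont u).measurable.ennreal_ofReal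
    rw [hlaw, integral_withDensity_eq_integral_toReal_smul hm
      (ae_of_all _ fun _ => ENNReal.ofReal_lt_top)]
    simp only [ENNReal.toReal_ofReal (hF0 u _), smul_eq_mul]
  have hkey := one_sub_le_integral_add_average P F (fun u => (hcont u).aestronglyMeasurable)
    (fun u => by simpa using (hint u fun _ => 1).symm)
    (fun u v => by
      simp_rw [hFF]
      rw [hPpi]
      exact Integrable.fintype_prod fun _ =>
        (integral_likelihoodRatio_mul (hpos u) (hpos v) (hM u v)).1) hδ
    (by
      refine le_trans (le_of_eq ?_) hchi
      congr 1
      refine Finset.sum_congr rfl fun u _ => Finset.sum_congr rfl fun v _ => ?_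
      simp_rw [hFF]
      rw [hPpi, integral_fintype_prod_eq_pow
        (fun x => likelihoodRatio (1 + A u) x * likelihoodRatio (1 + A v) x),
        (integral_likelihoodRatio_mul (hpos u) (hpos v) (hM u v)).2, Fintype.card_fin])
    hΔ.1 hΔ.2
  refine hkey.trans (add_le_add_right ?_ _)
  have hb : BddAbove (Set.range fun S : Q => ∫ x, (1 - Δ x) ∂(sampleLaw n p S.1)) :=
    ⟨1, by rintro _ ⟨S, rfl⟩; exact (integral_one_sub_mem_Icc hΔ S.1).2⟩
  have hle : ∀ u, ∫ x, F u x * (1 - Δ x) ∂P ≤ typeII Δ Q := fun u => by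
    rw [← hint u]
    exact le_ciSup hb ⟨_, hQ u⟩
  calc (Fintype.card U : ℝ)⁻¹ * ∑ u, ∫ x, F u x * (1 - Δ x) ∂P
      ≤ (Fintype.card U : ℝ)⁻¹ * ∑ _u : U, typeII Δ Q := by gcongr with u; exact hle u
    _ = typeII Δ Q := by simp

end

/-! ### Symmetric contractions -/

section Contraction

variable {ι : Type*} [Fintype ι] [DecidableEq ι]

lemma posDef_one_add {A : Matrix ι ι ℝ} (hs : A.IsSymm)
    (hA : ∀ y : ι → ℝ, y ≠ 0 → (A *ᵥ y) ⬝ᵥ (A *ᵥ y) < y ⬝ᵥ y) : (1 + A).PosDef := by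
  refine .of_dotProduct_mulVec_pos (by simpa [Matrix.IsHermitian] using hs.eq) fun y hy => ?_
  have h1 := hA y hy
  have h2 : 0 ≤ (y + A *ᵥ y) ⬝ᵥ (y + A *ᵥ y) := Finset.sum_nonneg fun i _ => mul_self_nonneg _
  rw [add_dotProduct, dotProduct_add, dotProduct_add, dotProduct_comm (A *ᵥ y) y] at h2
  rw [star_trivial, Matrix.add_mulVec, Matrix.one_mulVec, dotProduct_add]
  linarith

/-- If `A` is a strict contraction then `(1 + A)⁻¹` dominates `1/2`: with `x = (1 + A) z`, twice
the difference of the quadratic forms at `x` is `|z|² - |A z|²`. -/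
lemma half_dotProduct_lt_inv {A : Matrix ι ι ℝ} (hs : A.IsSymm)
    (hA : ∀ y : ι → ℝ, y ≠ 0 → (A *ᵥ y) ⬝ᵥ (A *ᵥ y) < y ⬝ᵥ y) {x : ι → ℝ} (hx : x ≠ 0) :
    x ⬝ᵥ x / 2 < x ⬝ᵥ (1 + A)⁻¹ *ᵥ x := by
  have hu : IsUnit (1 + A).det := (posDef_one_add hs hA).det_pos.ne'.isUnit
  set z := (1 + A)⁻¹ *ᵥ x with hz
  have hxz : x = z + A *ᵥ z := by
    have h : z + A *ᵥ z = (1 + A) *ᵥ z := by rw [Matrix.add_mulVec, Matrix.one_mulVec]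
    rw [h, hz, Matrix.mulVec_mulVec, Matrix.mul_nonsing_inv _ hu, Matrix.one_mulVec]
  have hz0 : z ≠ 0 := by
    rintro h
    rw [h] at hxz
    simp at hxz
    exact hx hxz
  have := hA z hz0
  rw [hxz]
  simp only [add_dotProduct, dotProduct_add, dotProduct_comm (A *ᵥ z) z]
  linarith

lemma posDef_inv_add_inv_sub_one {A A' : Matrix ι ι ℝ} (hs : A.IsSymm)
    (hA : ∀ y : ι → ℝ, y ≠ 0 → (A *ᵥ y) ⬝ᵥ (A *ᵥ y) < y ⬝ᵥ y) (hs' : A'.IsSymm)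
    (hA' : ∀ y : ι → ℝ, y ≠ 0 → (A' *ᵥ y) ⬝ᵥ (A' *ᵥ y) < y ⬝ᵥ y) :
    ((1 + A)⁻¹ + (1 + A')⁻¹ - 1).PosDef := by
  refine .of_dotProduct_mulVec_pos ?_ fun x hx => ?_
  · exact ((posDef_one_add hs hA).inv.1.add (posDef_one_add hs' hA').inv.1).sub
      Matrix.isHermitian_one
  · have h1 := half_dotProduct_lt_inv hs hA hx
    have h2 := half_dotProduct_lt_inv hs' hA' hx
    rw [star_trivial, Matrix.sub_mulVec, Matrix.add_mulVec, dotProduct_sub, dotProduct_add,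
      Matrix.one_mulVec]
    linarith

end Contraction

/-! ### Block spiked covariance matrices -/

/-- A sign vector viewed as a real vector. -/
def signVec {ι : Type*} (w : ι → ℤˣ) (i : ι) : ℝ := ((w i : ℤ) : ℝ)

lemma signVec_mul_self {ι : Type*} (w : ι → ℤˣ) (i : ι) : signVec w i * signVec w i = 1 := by
  unfold signVec
  rcases Int.units_eq_one_or (w i) with h | h <;> simp [h]

/-- Block diagonal perturbation of the identity: on each fibre of `b`, the matrix `ε (w wᵀ - 1)` for
the restriction of the sign vector `w`. -/
def spike {ι κ : Type*} [DecidableEq ι] [DecidableEq κ] (b : ι → κ) (ε : ℝ) (w : ι → ℤˣ) :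
    Matrix ι ι ℝ :=
  Matrix.of fun i j => if i ≠ j ∧ b i = b j then ε * signVec w i * signVec w j else 0

section Spike

variable {ι κ : Type*} [DecidableEq ι] [DecidableEq κ] (b : ι → κ) (ε : ℝ)

lemma spike_isSymm (w : ι → ℤˣ) : (spike b ε w).IsSymm := by
  ext i j
  simp only [spike, Matrix.transpose_apply, Matrix.of_apply, ne_comm (a := j), eq_comm (a := b j)]
  congr 1
  ring

lemma spike_sq (w : ι → ℤˣ) (i j : ι) :
    spike b ε w i j ^ 2 = if i ≠ j ∧ b i = b j then ε ^ 2 else 0 := by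
  simp only [spike, Matrix.of_apply]
  split_ifs
  · linear_combination ε ^ 2 * (signVec w j ^ 2 * signVec_mul_self w i + signVec_mul_self w j)
  · simp

variable {b ε}

lemma spike_contraction [Fintype ι] {T : ℕ} (hT : ∀ k, (Finset.univ.filter fun j => b j = k).card ≤ T)
    (hε : ε ^ 2 * T ^ 2 < 1) (w : ι → ℤˣ) (y : ι → ℝ) (hy : y ≠ 0) :
    (spike b ε w *ᵥ y) ⬝ᵥ (spike b ε w *ᵥ y) < y ⬝ᵥ y := by
  have hyy : 0 < y ⬝ᵥ y := by
    refine lt_of_le_of_ne (Finset.sum_nonneg fun i _ => mul_self_nonneg _) fun h => hy ?_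
    exact dotProduct_self_eq_zero.1 h.symm
  have hrow : ∀ i, (spike b ε w *ᵥ y) i ^ 2 ≤ ε ^ 2 * T * ∑ j with b j = b i, y j ^ 2 := by
    intro i
    have h1 : (spike b ε w *ᵥ y) i = ∑ j with b j = b i, spike b ε w i j * y j := by
      rw [Matrix.mulVec, dotProduct, Finset.sum_filter]
      refine Finset.sum_congr rfl fun j _ => ?_
      split_ifs with h
      · rfl
      · simp [spike, Ne.symm h]
    rw [h1]
    refine (Finset.sum_mul_sq_le_sq_mul_sq _ _ _).trans ?_
    refine mul_le_mul_of_nonneg_right ?_ (Finset.sum_nonneg fun j _ => sq_nonneg _)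
    calc ∑ j with b j = b i, spike b ε w i j ^ 2 ≤ ∑ j with b j = b i, ε ^ 2 := by
          refine Finset.sum_le_sum fun j _ => ?_
          rw [spike_sq]
          split_ifs
          exacts [le_rfl, sq_nonneg _]
      _ = (Finset.univ.filter fun j => b j = b i).card * ε ^ 2 := by simp
      _ ≤ T * ε ^ 2 := by
          gcongr
          exact_mod_cast hT (b i)
      _ = ε ^ 2 * T := mul_comm _ _
  calc (spike b ε w *ᵥ y) ⬝ᵥ (spike b ε w *ᵥ y) = ∑ i, (spike b ε w *ᵥ y) i ^ 2 := by
        simp [dotProduct, pow_two]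
    _ ≤ ∑ i, ε ^ 2 * T * ∑ j with b j = b i, y j ^ 2 := Finset.sum_le_sum fun i _ => hrow i
    _ = ε ^ 2 * T * ∑ j, (Finset.univ.filter fun i => b i = b j).card * y j ^ 2 := by
        rw [← Finset.mul_sum]
        congr 1
        simp_rw [Finset.sum_filter]
        rw [Finset.sum_comm]
        refine Finset.sum_congr rfl fun j _ => ?_
        rw [← Finset.sum_filter, Finset.sum_const, nsmul_eq_mul]
        simp_rw [eq_comm]
    _ ≤ ε ^ 2 * T * ∑ j, T * y j ^ 2 := by
        gcongr with j
        exact_mod_cast hT (b j)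
    _ = ε ^ 2 * T ^ 2 * y ⬝ᵥ y := by
        rw [← Finset.mul_sum, dotProduct]
        simp_rw [← pow_two]
        ring
    _ < y ⬝ᵥ y := by nlinarith

end Spike

/-- The determinant of `1 - A_u A_v` on a block with `t` coordinates on which the sign vectors have
inner product `s`, where `l = ε²`. -/
def blockDet (l : ℝ) (t : ℕ) (s : ℝ) : ℝ :=
  (1 - l) ^ t * (((1 - l + l * t) ^ 2 - l * s ^ 2) / (1 - l) ^ 2)

/-- Sylvester's identity reduces the determinant to that of a `2 × 2` matrix. -/
lemma det_one_sub_rankOne_mul {m : Type*} [Fintype m] [DecidableEq m] {ε : ℝ} (hε : ε ^ 2 ≠ 1)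
    (u v : m → ℝ) (hu : ∀ i, u i * u i = 1) (hv : ∀ i, v i * v i = 1) :
    (1 - (ε • (Matrix.vecMulVec u u - 1)) * (ε • (Matrix.vecMulVec v v - 1))).det =
      blockDet (ε ^ 2) (Fintype.card m) (u ⬝ᵥ v) := by
  have hl : 1 - ε ^ 2 ≠ 0 := sub_ne_zero.2 hε.symm
  set s := u ⬝ᵥ v with hs
  set c := ε ^ 2 / (1 - ε ^ 2) with hc
  have huu : u ⬝ᵥ u = Fintype.card m := by simp [dotProduct, hu]
  have hvv : v ⬝ᵥ v = Fintype.card m := by simp [dotProduct, hv]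
  let P : Matrix m (Fin 2) ℝ := Matrix.of fun i => ![u i, v i]
  let R : Matrix (Fin 2) m ℝ := Matrix.of ![-u + s • v, -v]
  have h1 : 1 - (ε • (Matrix.vecMulVec u u - 1)) * (ε • (Matrix.vecMulVec v v - 1)) =
      (1 - ε ^ 2) • (1 - P * (c • R)) := by
    have h2 : Matrix.vecMulVec u u * Matrix.vecMulVec v v = s • Matrix.vecMulVec u v := by
      rw [Matrix.vecMulVec_mul_vecMulVec]
      ext i j
      simp [Matrix.vecMulVec_apply]
      ring
    have h3 : P * R = s • Matrix.vecMulVec u v - Matrix.vecMulVec u u - Matrix.vecMulVec v v := by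
      ext i j
      simp [P, R, Matrix.mul_apply, Fin.sum_univ_two, Matrix.vecMulVec_apply]
      ring
    have h4 : (1 - ε ^ 2) * c = ε ^ 2 := by rw [hc]; field_simp
    rw [Matrix.mul_smul P, smul_sub (1 - ε ^ 2), smul_smul (1 - ε ^ 2), h4, h3, Matrix.smul_mul,
      Matrix.mul_smul, smul_smul ε, sub_mul, mul_sub, h2, ← pow_two]
    ext i j
    simp
    ring
  rw [h1, Matrix.det_smul, Matrix.det_one_sub_mul_comm, blockDet]
  congr 1
  have h5 : c • R * P = c • !![s ^ 2 - Fintype.card m, s * (Fintype.card m - 1);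
      -s, -(Fintype.card m : ℝ)] := by
    rw [Matrix.smul_mul]
    congr 1
    have e1 : (-u + s • v) ⬝ᵥ u = s ^ 2 - Fintype.card m := by
      rw [add_dotProduct, neg_dotProduct, smul_dotProduct, huu, dotProduct_comm v u, ← hs,
        smul_eq_mul]
      ring
    have e2 : (-u + s • v) ⬝ᵥ v = s * (Fintype.card m - 1) := by
      rw [add_dotProduct, neg_dotProduct, smul_dotProduct, hvv, ← hs, smul_eq_mul]
      ring
    have e3 : (-v) ⬝ᵥ u = -s := by rw [neg_dotProduct, dotProduct_comm v u]
    have e4 : (-v) ⬝ᵥ v = -(Fintype.card m : ℝ) := by rw [neg_dotProduct, hvv]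
    ext i j
    fin_cases i <;> fin_cases j
    exacts [e1, e2, e3, e4]
  rw [h5, Matrix.det_fin_two]
  simp [hc]
  field_simp
  ring

section BlockDet

variable {ι κ : Type*} [Fintype ι] [DecidableEq ι] [Fintype κ] [LinearOrder κ] (b : ι → κ) (ε : ℝ)

lemma spike_toSquareBlock {ι κ : Type*} [DecidableEq ι] [DecidableEq κ] (b : ι → κ) (ε : ℝ)
    (w : ι → ℤˣ) (k : κ) :
    (spike b ε w).toSquareBlock b k =
      ε • (Matrix.vecMulVec (fun i : {i // b i = k} => signVec w i)
        (fun i : {i // b i = k} => signVec w i) - 1) := by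
  ext ⟨i, hi⟩ ⟨j, hj⟩
  change spike b ε w i j = ε * (signVec w i * signVec w j - (1 : Matrix _ _ ℝ) _ _)
  by_cases h : i = j
  · subst h
    simp [spike, signVec_mul_self]
  · simp [spike, h, hi, hj, mul_assoc]

lemma det_one_sub_spike_mul (hε : ε ^ 2 ≠ 1) (u v : ι → ℤˣ) :
    (1 - spike b ε u * spike b ε v).det =
      ∏ k, blockDet (ε ^ 2) (Fintype.card {i // b i = k})
        (∑ i : {i // b i = k}, signVec (u * v) i) := by
  have htri : ∀ w, (spike b ε w).BlockTriangular b := fun w i j hij => by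
    simp [spike, hij.ne']
  have hT : (1 - spike b ε u * spike b ε v).BlockTriangular b :=
    Matrix.blockTriangular_one.sub ((htri u).mul (htri v))
  rw [hT.det_fintype]
  refine Finset.prod_congr rfl fun k _ => ?_
  have h1 : (1 - spike b ε u * spike b ε v).toSquareBlock b k =
      1 - (spike b ε u).toSquareBlock b k * (spike b ε v).toSquareBlock b k := by
    ext ⟨i, hi⟩ ⟨j, hj⟩
    change (1 : Matrix ι ι ℝ) i j - (spike b ε u * spike b ε v) i j =
      (1 : Matrix {i // b i = k} {i // b i = k} ℝ) ⟨i, hi⟩ ⟨j, hj⟩ -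
        ∑ l : {l // b l = k}, spike b ε u i l * spike b ε v l j
    simp only [Matrix.mul_apply, Matrix.one_apply, Subtype.mk.injEq]
    congr 1
    rw [← Finset.sum_subtype (Finset.univ.filter fun l => b l = k) (by simp)
      (fun l => spike b ε u i l * spike b ε v l j), Finset.sum_filter]
    refine Finset.sum_congr rfl fun l _ => ?_
    split_ifs with h
    · rfl
    · simp [spike, hi, Ne.symm h]
  rw [h1, spike_toSquareBlock, spike_toSquareBlock, det_one_sub_rankOne_mul hε]
  · congr 1
    simp [dotProduct, signVec]
  · exact fun i => signVec_mul_self u i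
  · exact fun i => signVec_mul_self v i

end BlockDet

/-! ### Lower bound for the block determinants -/

lemma exp_le_one_sub {x : ℝ} (hx : x < 1) : Real.exp (-(x / (1 - x))) ≤ 1 - x := by
  have h0 : 0 < 1 - x := sub_pos.2 hx
  have h := Real.add_one_le_exp (x / (1 - x))
  have h1 : x / (1 - x) + 1 = (1 - x)⁻¹ := by field_simp; ring
  rw [h1] at h
  rw [Real.exp_neg]
  exact inv_le_of_inv_le₀ h0 h

/-- Lower bound for `blockDet`, exact at first order in `l`: the term `l (s² - t)` is centred when
`s` is a sum of `t` independent signs. -/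
lemma exp_le_blockDet {l s : ℝ} {t : ℕ} (hl0 : 0 ≤ l) (hl : l ≤ 1 / 2) (hlt : l * t ^ 2 ≤ 1 / 2)
    (hs : s ^ 2 ≤ t ^ 2) :
    Real.exp (-(l * (s ^ 2 - t) + 8 * l ^ 2 * t ^ 2 + 2 * l ^ 2 * s ^ 4)) ≤ blockDet l t s := by
  rcases Nat.eq_zero_or_pos t with rfl | ht
  · have : s = 0 := by
      have : s ^ 2 ≤ 0 := by simpa using hs
      nlinarith
    subst this
    have : 1 - l ≠ 0 := by linarith
    simp [blockDet, this]
  have ht1 : (1 : ℝ) ≤ t := by exact_mod_cast ht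
  have h1l : 0 < 1 - l := by linarith
  set c := l / (1 - l) with hc
  have hc0 : 0 ≤ c := by positivity
  have hc1 : l + l ^ 2 ≤ c := by
    rw [hc, le_div_iff₀ h1l]
    nlinarith [pow_nonneg hl0 3]
  have hc2 : c ≤ 2 * l := by
    rw [hc, div_le_iff₀ h1l]
    nlinarith
  have hd : 1 ≤ 1 - l + l * t := by nlinarith
  set y := l * s ^ 2 / (1 - l + l * t) ^ 2 with hy
  have hy0 : 0 ≤ y := by positivity
  have hyl : y ≤ l * s ^ 2 := div_le_self (by positivity) (one_le_pow₀ hd)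
  have hls : l * s ^ 2 ≤ 1 / 2 := (mul_le_mul_of_nonneg_left hs hl0).trans hlt
  -- with `c = l / (1 - l)` each of the three factors is bounded below by an exponential; the terms
  -- of order `l² t` cancel because `l + l² ≤ c`
  have heq : blockDet l t s = (1 - l) ^ t * ((1 + c * t) ^ 2 * (1 - y)) := by
    rw [blockDet, hy, hc]
    congr 1
    field_simp
  have e1 : Real.exp (-(t * (l + 2 * l ^ 2))) ≤ (1 - l) ^ t := by
    rw [← mul_neg, Real.exp_nat_mul]
    refine pow_le_pow_left₀ (Real.exp_nonneg _) (le_trans ?_ (exp_le_one_sub (by linarith))) t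
    refine Real.exp_le_exp.2 (neg_le_neg ?_)
    rw [← hc, hc, div_le_iff₀ h1l]
    nlinarith [pow_nonneg hl0 2, mul_nonneg (pow_nonneg hl0 2) (sub_nonneg.2 hl)]
  have e2 : Real.exp (2 * (l + l ^ 2) * t - 8 * l ^ 2 * t ^ 2) ≤ (1 + c * t) ^ 2 := by
    have ha : 0 ≤ c * t := by positivity
    have h := exp_le_one_sub (x := -(c * t)) (by linarith)
    rw [sub_neg_eq_add] at h
    refine le_trans ?_ (pow_le_pow_left₀ (Real.exp_nonneg _) h 2)
    rw [← Real.exp_nat_mul]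
    refine Real.exp_le_exp.2 ?_
    have h2 : c * t - (c * t) ^ 2 ≤ -(-(c * t) / (1 + c * t)) := by
      rw [neg_div, neg_neg, le_div_iff₀ (by linarith)]
      nlinarith [pow_nonneg ha 3]
    have h3 : (c * t) ^ 2 ≤ (2 * l * t) ^ 2 := by gcongr
    have h4 : (l + l ^ 2) * t ≤ c * t := by gcongr
    push_cast
    nlinarith
  have e3 : Real.exp (-(l * s ^ 2 + 2 * l ^ 2 * s ^ 4)) ≤ 1 - y := by
    refine le_trans (Real.exp_le_exp.2 (neg_le_neg ?_)) (exp_le_one_sub (by linarith))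
    have h1 : y / (1 - y) ≤ y + 2 * y ^ 2 := by
      rw [div_le_iff₀ (by linarith)]
      nlinarith [pow_nonneg hy0 2, mul_nonneg (pow_nonneg hy0 2) (by linarith : 0 ≤ 1 / 2 - y)]
    have h2 : y ^ 2 ≤ (l * s ^ 2) ^ 2 := by gcongr
    nlinarith
  rw [heq]
  calc _ = Real.exp (-(t * (l + 2 * l ^ 2))) * (Real.exp (2 * (l + l ^ 2) * t - 8 * l ^ 2 * t ^ 2) *
        Real.exp (-(l * s ^ 2 + 2 * l ^ 2 * s ^ 4))) := by
        rw [← Real.exp_add, ← Real.exp_add]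
        congr 1
        ring
    _ ≤ _ := by gcongr

/-! ### Sums of independent signs -/

section Signs

variable {m : Type*} [Fintype m] [DecidableEq m]

lemma sum_sum_signVec_sq :
    ∑ w : m → ℤˣ, (∑ i, signVec w i) ^ 2 = Fintype.card (m → ℤˣ) * Fintype.card m := by
  have hoff : ∀ i j : m, ∑ w : m → ℤˣ, signVec w i * signVec w j =
      if i = j then (Fintype.card (m → ℤˣ) : ℝ) else 0 := by
    intro i j
    split_ifs with h
    · subst h
      simp [signVec_mul_self]
    -- flipping the sign of the `i`-th coordinate changes the sign of the sum
    · have := Fintype.sum_equiv (Equiv.mulRight (Pi.mulSingle i (-1 : ℤˣ)))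
        (fun w : m → ℤˣ => -(signVec w i * signVec w j)) (fun w => signVec w i * signVec w j)
        fun w => by simp [signVec, Pi.mulSingle_eq_of_ne' h]
      rw [Finset.sum_neg_distrib] at this
      linarith
  simp_rw [pow_two, Finset.sum_mul_sum]
  rw [Finset.sum_comm]
  simp_rw [Finset.sum_comm (s := (Finset.univ : Finset (m → ℤˣ))), hoff]
  simp
  ring

lemma sum_exp_mul_sum_signVec_le (a : ℝ) :
    ∑ w : m → ℤˣ, Real.exp (a * ∑ i, signVec w i) ≤
      Fintype.card (m → ℤˣ) * Real.exp (Fintype.card m * a ^ 2 / 2) := by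
  have h1 : ∀ w : m → ℤˣ, Real.exp (a * ∑ i, signVec w i) =
      ∏ i, Real.exp (a * ((w i : ℤ) : ℝ)) := fun w => by
    rw [Finset.mul_sum, Real.exp_sum]
    rfl
  simp_rw [h1]
  have h2 := Finset.prod_univ_sum (fun _ : m => (Finset.univ : Finset ℤˣ))
    (fun _ e => Real.exp (a * ((e : ℤ) : ℝ)))
  rw [Fintype.piFinset_univ] at h2
  rw [← h2]
  have h3 : ∑ e : ℤˣ, Real.exp (a * ((e : ℤ) : ℝ)) = 2 * Real.cosh a := by
    rw [UnitsInt.univ, Finset.sum_pair (by decide), Real.cosh_eq]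
    simp
    ring
  rw [Finset.prod_const, h3, Finset.card_univ, mul_pow, Fintype.card_fun, Fintype.card_units_int,
    mul_div_assoc, Real.exp_nat_mul]
  push_cast
  have := Real.cosh_le_exp_half_sq a
  have h4 := (Real.cosh_pos a).le
  gcongr

lemma integral_exp_linear_sub_sq {T : ℝ} (hT : 0 < T) (s : ℝ) :
    ∫ x : ℝ, Real.exp (s * x - T * x ^ 2) = Real.exp (s ^ 2 / (4 * T)) * √(Real.pi / T) := by
  have h : ∀ x : ℝ, Real.exp (s * x - T * x ^ 2) =
      Real.exp (s ^ 2 / (4 * T)) * Real.exp (-T * (x - s / (2 * T)) ^ 2) := fun x => by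
    rw [← Real.exp_add]
    congr 1
    field_simp
    ring
  simp_rw [h]
  rw [integral_const_mul, integral_sub_right_eq_self (fun x => Real.exp (-T * x ^ 2)),
    integral_gaussian]

/-- Square-exponential moment of a sum of signs: write the exponential of the square as a Gaussian
integral of exponentials and use that signs are sub-Gaussian. -/
lemma sum_exp_sq_signVec_le {T : ℝ} (hT : 0 < T) (hm : Fintype.card m ≤ T) :
    ∑ w : m → ℤˣ, Real.exp ((∑ i, signVec w i) ^ 2 / (4 * T)) ≤
      Fintype.card (m → ℤˣ) * √2 := by
  have hpos : 0 < √(Real.pi / T) := by positivity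
  have hint : ∀ s : ℝ, Integrable fun x : ℝ => Real.exp (s * x - T * x ^ 2) := fun s => by
    -- a function with nonzero Bochner integral is integrable
    by_contra h
    have h1 := integral_undef h
    rw [integral_exp_linear_sub_sq hT] at h1
    have : 0 < Real.exp (s ^ 2 / (4 * T)) * √(Real.pi / T) := by positivity
    linarith
  refine le_of_mul_le_mul_right ?_ hpos
  rw [Finset.sum_mul]
  simp_rw [← integral_exp_linear_sub_sq hT]
  rw [← integral_finsetSum _ fun w _ => hint _]
  have hb : ∀ x : ℝ, ∑ w : m → ℤˣ, Real.exp ((∑ i, signVec w i) * x - T * x ^ 2) ≤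
      Fintype.card (m → ℤˣ) * Real.exp (-(T / 2) * x ^ 2) := fun x => by
    have h1 := sum_exp_mul_sum_signVec_le (m := m) x
    simp_rw [sub_eq_add_neg, Real.exp_add]
    rw [← Finset.sum_mul]
    simp_rw [mul_comm _ x]
    calc _ ≤ Fintype.card (m → ℤˣ) * Real.exp (Fintype.card m * x ^ 2 / 2) *
          Real.exp (-(T * x ^ 2)) := by gcongr
      _ ≤ Fintype.card (m → ℤˣ) * Real.exp (T * x ^ 2 / 2) * Real.exp (-(T * x ^ 2)) := by gcongr
      _ = _ := by
        rw [mul_assoc, ← Real.exp_add]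
        ring_nf
  have hT2 : 0 < T / 2 := by positivity
  refine (integral_mono (integrable_finsetSum _ fun w _ => hint _)
    ((integrable_exp_neg_mul_sq hT2).const_mul _) hb).trans (le_of_eq ?_)
  rw [integral_const_mul, integral_gaussian, mul_assoc, ← Real.sqrt_mul (by norm_num)]
  congr 2
  field_simp

lemma exp_le_one_add_add_sq_mul_exp (z : ℝ) :
    Real.exp z ≤ 1 + z + z ^ 2 * Real.exp |z| := by
  have h := Complex.norm_exp_sub_sum_le_norm_mul_exp (z : ℂ) 2
  have h1 : Complex.exp z - ∑ k ∈ Finset.range 2, (z : ℂ) ^ k / k.factorial =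
      ((Real.exp z - (1 + z) : ℝ) : ℂ) := by
    simp [Finset.sum_range_succ]
  rw [h1, Complex.norm_real, Complex.norm_real, Real.norm_eq_abs, Real.norm_eq_abs, sq_abs] at h
  linarith [le_abs_self (Real.exp z - (1 + z))]

lemma sq_mul_exp_abs_le {θ W z : ℝ} (hθ : θ ≤ 1 / 8) (hW0 : 0 ≤ W)
    (hz : |z| ≤ θ * (W + 1)) : z ^ 2 * Real.exp |z| ≤ θ ^ 2 * (171 * Real.exp (W / 4)) := by
  have h1 : z ^ 2 ≤ θ ^ 2 * (W + 1) ^ 2 := by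
    rw [← sq_abs, ← mul_pow]
    exact pow_le_pow_left₀ (abs_nonneg z) hz 2
  have h2 : Real.exp |z| ≤ Real.exp ((W + 1) / 8) := by
    refine Real.exp_le_exp.2 (hz.trans ?_)
    nlinarith
  have h3 : (W + 1) ^ 2 ≤ 128 * Real.exp ((W + 1) / 8) := by
    have := Real.quadratic_le_exp_of_nonneg (x := (W + 1) / 8) (by positivity)
    linarith
  have h4 : Real.exp ((W + 1) / 8) * Real.exp ((W + 1) / 8) =
      Real.exp (W / 4) * Real.exp (1 / 4) := by
    rw [← Real.exp_add, ← Real.exp_add]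
    ring_nf
  have h5 : Real.exp (1 / 4) ≤ 4 / 3 := by
    have h := exp_le_one_sub (x := -(1 / 3)) (by norm_num)
    norm_num at h ⊢
    linarith
  calc z ^ 2 * Real.exp |z| ≤ θ ^ 2 * (W + 1) ^ 2 * Real.exp ((W + 1) / 8) := by gcongr
    _ ≤ θ ^ 2 * (128 * Real.exp ((W + 1) / 8)) * Real.exp ((W + 1) / 8) := by gcongr
    _ = θ ^ 2 * (128 * (Real.exp (W / 4) * Real.exp (1 / 4))) := by rw [← h4]; ring
    _ ≤ θ ^ 2 * (128 * (Real.exp (W / 4) * (4 / 3))) := by gcongr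
    _ ≤ θ ^ 2 * (171 * Real.exp (W / 4)) := by
      have := Real.exp_pos (W / 4)
      refine mul_le_mul_of_nonneg_left ?_ (sq_nonneg θ)
      linarith

/-- Second order expansion of the exponential of `n/2` times the exponent of `exp_le_blockDet`: a
remainder of order `(n l T)²`, up to a square-exponential factor in `s`. -/
lemma exp_block_le {n T t : ℕ} {l s : ℝ} (hl0 : 0 ≤ l) (hT : 1 ≤ T) (ht : t ≤ T)
    (hs : s ^ 2 ≤ t ^ 2) (hlT : l * T ^ 2 ≤ 1 / 8) (hn : n * l * T ≤ 1 / 8) :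
    Real.exp (n / 2 * (l * (s ^ 2 - t) + 8 * l ^ 2 * (t : ℝ) ^ 2 + 2 * l ^ 2 * s ^ 4)) ≤
      1 + n / 2 * l * (s ^ 2 - t) +
        (n * l * T) ^ 2 * (4 + 203 * Real.exp (s ^ 2 / (4 * T))) := by
  have hT1 : (1 : ℝ) ≤ T := by exact_mod_cast hT
  have htT : (t : ℝ) ≤ T := by exact_mod_cast ht
  have ht0 : (0 : ℝ) ≤ t := by positivity
  have hn0 : (0 : ℝ) ≤ n := by positivity
  have hnn : (n : ℝ) ≤ (n : ℝ) ^ 2 := by exact_mod_cast Nat.le_self_pow two_ne_zero n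
  set θ := n * l * T with hθ
  have hθ0 : 0 ≤ θ := by positivity
  set W := s ^ 2 / T with hW
  have hW0 : 0 ≤ W := by positivity
  have hsW : s ^ 2 = T * W := by rw [hW]; field_simp
  have hs4 : s ^ 4 = T ^ 2 * W ^ 2 := by rw [← mul_pow, ← hsW]; ring
  have hse : s ^ 2 / (4 * T) = W / 4 := by rw [hW]; field_simp
  rw [hse]
  set e := Real.exp (W / 4) with he
  have hWe : W ^ 2 ≤ 32 * e := by
    have := Real.quadratic_le_exp_of_nonneg (x := W / 4) (by positivity)
    nlinarith
  set z := n / 2 * (l * (s ^ 2 - t) + 8 * l ^ 2 * (t : ℝ) ^ 2 + 2 * l ^ 2 * s ^ 4) with hz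
  have htt : (t : ℝ) ^ 2 ≤ T ^ 2 := by gcongr
  have hnl : n * l ^ 2 * T ^ 2 ≤ θ ^ 2 := by
    calc n * l ^ 2 * T ^ 2 ≤ (n : ℝ) ^ 2 * l ^ 2 * T ^ 2 := by gcongr
      _ = θ ^ 2 := by rw [hθ]; ring
  have hlin : z ≤ n / 2 * l * (s ^ 2 - t) + θ ^ 2 * (4 + 32 * e) := by
    have h1 : n * l ^ 2 * (t : ℝ) ^ 2 ≤ θ ^ 2 := by
      refine le_trans ?_ hnl
      gcongr
    have h2 : n * l ^ 2 * s ^ 4 ≤ θ ^ 2 * (32 * e) := by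
      rw [hs4, ← mul_assoc]
      gcongr
    rw [hz]
    linarith
  have habs : |z| ≤ θ * (W + 1) := by
    have hlt : l * t ^ 2 ≤ 1 / 8 := (mul_le_mul_of_nonneg_left htt hl0).trans hlT
    have hls : l * s ^ 2 ≤ 1 / 8 := (mul_le_mul_of_nonneg_left hs hl0).trans hlt
    have h1 : 8 * l ^ 2 * (t : ℝ) ^ 2 ≤ l * T := by
      calc 8 * l ^ 2 * (t : ℝ) ^ 2 = 8 * l * (l * t ^ 2) := by ring
        _ ≤ 8 * l * (1 / 8) := by gcongr
        _ ≤ l * T := by nlinarith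
    have h2 : 2 * l ^ 2 * s ^ 4 ≤ l * s ^ 2 := by
      calc 2 * l ^ 2 * s ^ 4 = 2 * (l * s ^ 2) * (l * s ^ 2) := by ring
        _ ≤ 2 * (1 / 8) * (l * s ^ 2) := by gcongr
        _ ≤ l * s ^ 2 := by nlinarith [mul_nonneg hl0 (sq_nonneg s)]
    have h3 : 0 ≤ 8 * l ^ 2 * (t : ℝ) ^ 2 := by positivity
    have h4 : 0 ≤ 2 * l ^ 2 * s ^ 4 := by positivity
    have h5 : l * t ≤ l * T := by gcongr
    have h6 : 0 ≤ l * s ^ 2 := by positivity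
    have h7 : 0 ≤ l * T := by positivity
    have h9 : 0 ≤ l * t := by positivity
    have h8 : θ * (W + 1) = n / 2 * (2 * (l * s ^ 2) + 2 * (l * T)) := by
      rw [hθ, hsW]
      ring
    rw [hz, h8, abs_mul, abs_of_nonneg (by positivity : (0 : ℝ) ≤ n / 2)]
    refine mul_le_mul_of_nonneg_left (abs_le.2 ⟨?_, ?_⟩) (by positivity) <;> linarith
  have hquad := sq_mul_exp_abs_le hn hW0 habs
  rw [← he] at hquad
  have := exp_le_one_add_add_sq_mul_exp z
  linarith

lemma sq_sum_signVec_le {m : Type*} [Fintype m] (w : m → ℤˣ) :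
    (∑ i, signVec w i) ^ 2 ≤ (Fintype.card m : ℝ) ^ 2 := by
  have h : ∑ i, signVec w i ^ 2 = (Fintype.card m : ℝ) := by simp [pow_two, signVec_mul_self]
  have h1 := Finset.sum_mul_sq_le_sq_mul_sq Finset.univ (signVec w) fun _ => 1
  simpa [h, ← pow_two] using h1

/-- Average over the signs of one block of the bound for `blockDet ^ (-n/2)`. The linear term is
centred, so the excess over `1` is quadratic in `n l T`. -/
lemma average_exp_block_le {n T : ℕ} {l : ℝ} (hl0 : 0 ≤ l) (hT : 1 ≤ T) (hm : Fintype.card m ≤ T)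
    (hlT : l * T ^ 2 ≤ 1 / 8) (hn : n * l * T ≤ 1 / 8) :
    (Fintype.card (m → ℤˣ) : ℝ)⁻¹ * ∑ w : m → ℤˣ,
      Real.exp (n / 2 * (l * ((∑ i, signVec w i) ^ 2 - Fintype.card m) +
        8 * l ^ 2 * (Fintype.card m : ℝ) ^ 2 + 2 * l ^ 2 * (∑ i, signVec w i) ^ 4)) ≤
      1 + 400 * (n * l * T) ^ 2 := by
  have hN : (0 : ℝ) < Fintype.card (m → ℤˣ) := by exact_mod_cast Fintype.card_pos
  rw [inv_mul_le_iff₀ hN]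
  refine (Finset.sum_le_sum fun w _ => exp_block_le hl0 hT hm (sq_sum_signVec_le w) hlT hn).trans ?_
  have hT0 : (0 : ℝ) < T := by exact_mod_cast hT
  have h1 := sum_exp_sq_signVec_le (m := m) hT0 (by exact_mod_cast hm)
  have h2 : √2 ≤ 3 / 2 := Real.sqrt_le_iff.2 (by norm_num)
  have h3 : ∑ w : m → ℤˣ, (n / 2 * l * ((∑ i, signVec w i) ^ 2 - Fintype.card m)) = 0 := by
    rw [← Finset.mul_sum, Finset.sum_sub_distrib, sum_sum_signVec_sq]
    simp
  rw [Finset.sum_add_distrib, Finset.sum_add_distrib, h3, ← Finset.mul_sum,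
    Finset.sum_add_distrib, ← Finset.mul_sum]
  simp only [Finset.sum_const, Finset.card_univ, nsmul_eq_mul, mul_one, add_zero]
  set N : ℝ := (Fintype.card (m → ℤˣ) : ℝ)
  set Y := ∑ w : m → ℤˣ, Real.exp ((∑ i, signVec w i) ^ 2 / (4 * T))
  have h4 : Y ≤ N * (3 / 2) := h1.trans (by gcongr)
  have h5 : N * 4 + 203 * Y ≤ 400 * N := by linarith
  have h6 := mul_le_mul_of_nonneg_left h5 (sq_nonneg ((n : ℝ) * l * T))
  linarith

end Signs

/-! ### Second moment of the mixture likelihood ratio -/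

section

/-- A sum over sign vectors of a product of functions of the blocks factorizes. -/
lemma sum_prod_fiber {ι κ : Type*} [Fintype ι] [DecidableEq ι] [Fintype κ] [DecidableEq κ]
    (b : ι → κ) (g : ∀ k, ({i // b i = k} → ℤˣ) → ℝ) :
    ∑ w : ι → ℤˣ, ∏ k, g k (fun i => w i) = ∏ k, ∑ w : {i // b i = k} → ℤˣ, g k w := by
  have h := Finset.prod_univ_sum (fun k => (Finset.univ : Finset ({i // b i = k} → ℤˣ))) g
  rw [Fintype.piFinset_univ] at h
  rw [h]
  exact Fintype.sum_equiv ((Equiv.arrowCongr (Equiv.sigmaFiberEquiv b).symm (Equiv.refl ℤˣ)).trans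
    (Equiv.piCurry fun _ _ => ℤˣ)) _ _ fun w => rfl

lemma card_signs_eq_prod {ι κ : Type*} [Fintype ι] [DecidableEq ι] [Fintype κ] [DecidableEq κ]
    (b : ι → κ) :
    (Fintype.card (ι → ℤˣ) : ℝ) = ∏ k, (Fintype.card ({i // b i = k} → ℤˣ) : ℝ) := by
  simpa using sum_prod_fiber b fun _ _ => 1

variable {ι κ : Type*} [Fintype ι] [DecidableEq ι] [Fintype κ] [LinearOrder κ] {b : ι → κ}

lemma inv_sqrt_det_pow_le {n T : ℕ} {ε : ℝ} (hb : ∀ k, Fintype.card {i // b i = k} ≤ T)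
    (hT : 1 ≤ T) (hεT : ε ^ 2 * T ^ 2 ≤ 1 / 8) (u v : ι → ℤˣ) :
    (√(1 - spike b ε u * spike b ε v).det)⁻¹ ^ n ≤
      ∏ k, Real.exp (n / 2 * (ε ^ 2 * ((∑ i : {i // b i = k}, signVec (u * v) i) ^ 2 -
        Fintype.card {i // b i = k}) + 8 * (ε ^ 2) ^ 2 * (Fintype.card {i // b i = k} : ℝ) ^ 2 +
        2 * (ε ^ 2) ^ 2 * (∑ i : {i // b i = k}, signVec (u * v) i) ^ 4)) := by
  have hT1 : (1 : ℝ) ≤ T := by exact_mod_cast hT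
  have hε0 := sq_nonneg ε
  have hε : ε ^ 2 ≤ 1 / 8 := (le_mul_of_one_le_right hε0 (one_le_pow₀ hT1)).trans hεT
  rw [det_one_sub_spike_mul b ε (by intro h; linarith)]
  set z : κ → ℝ := fun k => ε ^ 2 * ((∑ i : {i // b i = k}, signVec (u * v) i) ^ 2 -
        Fintype.card {i // b i = k}) + 8 * (ε ^ 2) ^ 2 * (Fintype.card {i // b i = k} : ℝ) ^ 2 +
        2 * (ε ^ 2) ^ 2 * (∑ i : {i // b i = k}, signVec (u * v) i) ^ 4 with hz
  have h1 : ∀ k, Real.exp (-z k) ≤ blockDet (ε ^ 2) (Fintype.card {i // b i = k})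
      (∑ i : {i // b i = k}, signVec (u * v) i) := fun k => by
    refine exp_le_blockDet hε0 (by linarith) ?_
      (sq_sum_signVec_le (fun i : {i // b i = k} => (u * v) i))
    have : (Fintype.card {i // b i = k} : ℝ) ≤ T := by exact_mod_cast hb k
    calc ε ^ 2 * (Fintype.card {i // b i = k} : ℝ) ^ 2 ≤ ε ^ 2 * T ^ 2 := by gcongr
      _ ≤ 1 / 2 := by linarith
  have h2 : Real.exp (-∑ k, z k) ≤ ∏ k, blockDet (ε ^ 2) (Fintype.card {i // b i = k})
      (∑ i : {i // b i = k}, signVec (u * v) i) := by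
    rw [← Finset.sum_neg_distrib, Real.exp_sum]
    exact Finset.prod_le_prod (fun k _ => (Real.exp_pos _).le) fun k _ => h1 k
  rw [← Real.exp_sum, ← Finset.mul_sum]
  have h3 : Real.exp (-(∑ k, z k) / 2) ≤ √(∏ k, blockDet (ε ^ 2) (Fintype.card {i // b i = k})
      (∑ i : {i // b i = k}, signVec (u * v) i)) := by
    refine Real.le_sqrt_of_sq_le (le_trans (le_of_eq ?_) h2)
    rw [← Real.exp_nat_mul]
    congr 1
    push_cast
    ring
  calc _ ≤ (Real.exp (-(∑ k, z k) / 2))⁻¹ ^ n := by gcongr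
    _ = _ := by
      rw [← Real.exp_neg, ← Real.exp_nat_mul]
      congr 1
      simp only [hz]
      ring

/-- The second moment of the likelihood ratio of the uniform mixture of block spiked models is a
product over the blocks, since it depends on `u, v` only through the uniform sign vector `u v`. -/
lemma average_inv_sqrt_det_pow_le {n T : ℕ} {ε : ℝ}
    (hb : ∀ k, Fintype.card {i // b i = k} ≤ T) (hT : 1 ≤ T) (hεT : ε ^ 2 * T ^ 2 ≤ 1 / 8)
    (hn : n * ε ^ 2 * T ≤ 1 / 8) :
    ((Fintype.card (ι → ℤˣ) : ℝ)⁻¹) ^ 2 *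
      ∑ u, ∑ v, (√(1 - spike b ε u * spike b ε v).det)⁻¹ ^ n ≤
      (1 + 400 * (n * ε ^ 2 * T) ^ 2) ^ Fintype.card κ := by
  set g : ∀ k, ({i // b i = k} → ℤˣ) → ℝ := fun k w =>
    Real.exp (n / 2 * (ε ^ 2 * ((∑ i, signVec w i) ^ 2 -
        Fintype.card {i // b i = k}) + 8 * (ε ^ 2) ^ 2 * (Fintype.card {i // b i = k} : ℝ) ^ 2 +
        2 * (ε ^ 2) ^ 2 * (∑ i, signVec w i) ^ 4)) with hg
  have h1 : ∀ u : ι → ℤˣ, ∑ v, (√(1 - spike b ε u * spike b ε v).det)⁻¹ ^ n ≤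
      ∏ k, ∑ w : {i // b i = k} → ℤˣ, g k w := fun u => by
    rw [← sum_prod_fiber]
    calc _ ≤ ∑ v : ι → ℤˣ, ∏ k, g k (fun i => (u * v) i) :=
          Finset.sum_le_sum fun v _ => inv_sqrt_det_pow_le hb hT hεT u v
      _ = _ := Fintype.sum_equiv (Equiv.mulLeft u) _ _ fun v => rfl
  have hN : (0 : ℝ) < Fintype.card (ι → ℤˣ) := by exact_mod_cast Fintype.card_pos
  calc _ ≤ ((Fintype.card (ι → ℤˣ) : ℝ)⁻¹) ^ 2 *
        ∑ _u : ι → ℤˣ, ∏ k, ∑ w : {i // b i = k} → ℤˣ, g k w := by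
        gcongr with u
        exact h1 u
    _ = (Fintype.card (ι → ℤˣ) : ℝ)⁻¹ * ∏ k, ∑ w : {i // b i = k} → ℤˣ, g k w := by
        rw [Finset.sum_const, Finset.card_univ, nsmul_eq_mul]
        field_simp
    _ = ∏ k, ((Fintype.card ({i // b i = k} → ℤˣ) : ℝ)⁻¹ *
          ∑ w : {i // b i = k} → ℤˣ, g k w) := by
        rw [card_signs_eq_prod b, Finset.prod_mul_distrib, Finset.prod_inv_distrib]
    _ ≤ ∏ _k : κ, (1 + 400 * (n * ε ^ 2 * T) ^ 2) :=
        Finset.prod_le_prod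
          (fun k _ => mul_nonneg (by positivity)
            (Finset.sum_nonneg fun w _ => (Real.exp_pos _).le))
          fun k _ => average_exp_block_le (sq_nonneg ε) hT (hb k) hεT hn
    _ = _ := by rw [Finset.prod_const, Finset.card_univ]

end

/-! ### The spiked matrices belong to the alternative -/

/-- The block of length `T` containing an index; the last block may be shorter or empty. -/
def blockIdx (p T : ℕ) (i : Fin p) : Fin (p / T + 1) :=
  ⟨i / T, Nat.lt_succ_of_le (Nat.div_le_div_right i.2.le)⟩

lemma card_block_le {p T : ℕ} (hT : 1 ≤ T) (k : Fin (p / T + 1)) :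
    Fintype.card {i // blockIdx p T i = k} ≤ T := by
  have h : Function.Injective fun i : {i // blockIdx p T i = k} =>
      (⟨i.1 % T, Nat.mod_lt _ hT⟩ : Fin T) := by
    rintro ⟨i, hi⟩ ⟨j, hj⟩ hij
    have h1 : (i : ℕ) / T = j / T := congrArg Fin.val (hi.trans hj.symm)
    have h2 : (i : ℕ) % T = j % T := congrArg Fin.val hij
    refine Subtype.ext (Fin.ext ?_)
    rw [← Nat.div_add_mod i T, ← Nat.div_add_mod j T, h1, h2]
  simpa using Fintype.card_le_of_injective _ h

/-- By the Cauchy–Schwarz inequality, few blocks force many pairs of indices in a common block. -/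
lemma sq_card_le_card_mul_pairs {ι κ : Type*} [Fintype ι] [Fintype κ] [DecidableEq κ] (b : ι → κ) :
    (Fintype.card ι : ℝ) ^ 2 ≤ Fintype.card κ * ∑ i, ∑ j, if b i = b j then (1 : ℝ) else 0 := by
  set t : κ → ℝ := fun k => ∑ i, if b i = k then (1 : ℝ) else 0 with ht
  have h1 : ∑ k, t k = Fintype.card ι := by
    simp only [ht]
    rw [Finset.sum_comm]
    simp
  have h2 : ∑ i, ∑ j, (if b i = b j then (1 : ℝ) else 0) = ∑ k, t k ^ 2 := by
    have h3 : ∀ k, t k ^ 2 = ∑ i, ∑ j, if b i = k then (if b j = k then (1 : ℝ) else 0) else 0 := by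
      intro k
      simp only [ht]
      rw [pow_two, Finset.sum_mul_sum]
      refine Finset.sum_congr rfl fun i _ => Finset.sum_congr rfl fun j _ => ?_
      split_ifs <;> simp
    simp_rw [h3]
    symm
    rw [Finset.sum_comm]
    refine Finset.sum_congr rfl fun i _ => ?_
    rw [Finset.sum_comm]
    refine Finset.sum_congr rfl fun j _ => ?_
    simp [eq_comm]
  rw [h2, ← h1]
  exact sq_sum_le_card_mul_sum_sq

lemma pairs_eq {p : ℕ} {κ : Type*} [DecidableEq κ] (b : Fin p → κ) :
    ∑ i, ∑ j, (if b i = b j then (1 : ℝ) else 0) =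
      2 * (∑ i, ∑ j ∈ Finset.Ioi i, if b i = b j then (1 : ℝ) else 0) + p := by
  have h := Finset.sum_sum_Ioi_add_eq_sum_sum_off_diag
    fun i j : Fin p => if b i = b j then (1 : ℝ) else 0
  have h1 : ∀ i, ∑ j, (if b i = b j then (1 : ℝ) else 0) =
      ∑ j ∈ {i}ᶜ, (if b j = b i then (1 : ℝ) else 0) + 1 := fun i => by
    rw [← Finset.sum_compl_add_sum {i}, Finset.sum_singleton]
    simp [eq_comm]
  simp_rw [h1]
  rw [Finset.sum_add_distrib, ← h]
  have h2 : ∀ i j, ((if b j = b i then (1 : ℝ) else 0) + if b i = b j then 1 else 0) =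
      2 * if b i = b j then 1 else 0 := fun i j => by
    simp only [eq_comm (a := b j)]
    ring
  simp_rw [h2, ← Finset.mul_sum]
  simp

lemma one_add_spike_apply_sq {p : ℕ} {κ : Type*} [DecidableEq κ] (b : Fin p → κ) (ε : ℝ)
    (w : Fin p → ℤˣ) {i j : Fin p} (hij : i < j) :
    (1 + spike b ε w) i j ^ 2 = ε ^ 2 * if b i = b j then 1 else 0 := by
  rw [Matrix.add_apply, Matrix.one_apply_ne hij.ne, zero_add, spike_sq]
  simp [hij.ne]

lemma one_add_spike_mem_classQ {p T : ℕ} {α L φ ε : ℝ} (hα : 0 < α) (hT : 4 ≤ T) (hTp : T ≤ p)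
    (hε : ε ^ 2 * T = 8 * φ ^ 2) (hL : 8 * φ ^ 2 * (T : ℝ) ^ (2 * α) ≤ L) (w : Fin p → ℤˣ)
    (hpos : (1 + spike (blockIdx p T) ε w).PosDef) :
    1 + spike (blockIdx p T) ε w ∈ classQ p α L φ := by
  have hT4 : (4 : ℝ) ≤ T := by exact_mod_cast hT
  have hTp' : (T : ℝ) ≤ p := by exact_mod_cast hTp
  have hp0 : (0 : ℝ) < p := by linarith
  refine ⟨⟨hpos.posSemidef, fun i => by simp [spike], ?_⟩, ?_⟩
  · rw [one_div, inv_mul_le_iff₀ hp0]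
    calc ∑ i : Fin p, ∑ j ∈ Finset.Ioi i, (1 + spike (blockIdx p T) ε w) i j ^ 2 *
          |(i : ℝ) - (j : ℝ)| ^ (2 * α)
        ≤ ∑ i : Fin p, ∑ j ∈ Finset.Ioi i,
          ε ^ 2 * (T : ℝ) ^ (2 * α) * if blockIdx p T i = blockIdx p T j then 1 else 0 := by
          refine Finset.sum_le_sum fun i _ => Finset.sum_le_sum fun j hj => ?_
          rw [one_add_spike_apply_sq _ _ _ (Finset.mem_Ioi.1 hj)]
          split_ifs with h
          · rw [mul_one, mul_one]
            refine mul_le_mul_of_nonneg_left (Real.rpow_le_rpow (abs_nonneg _) ?_ (by linarith))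
              (sq_nonneg ε)
            have h1 : (i : ℕ) / T = j / T := congrArg Fin.val h
            have h2 := Nat.div_add_mod i T
            have h3 := Nat.div_add_mod j T
            have h4 := Nat.mod_lt i (by omega : T > 0)
            have h5 := Nat.mod_lt j (by omega : T > 0)
            rw [h1] at h2
            have h6 : (i : ℕ) ≤ j + T := by omega
            have h7 : (j : ℕ) ≤ i + T := by omega
            have h6' : (i : ℝ) ≤ j + T := by exact_mod_cast h6
            have h7' : (j : ℝ) ≤ i + T := by exact_mod_cast h7
            rw [abs_le]
            constructor <;> linarith
          · simp
      _ ≤ ∑ i : Fin p, ∑ j : Fin p,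
          ε ^ 2 * (T : ℝ) ^ (2 * α) * if blockIdx p T i = blockIdx p T j then 1 else 0 := by
          refine Finset.sum_le_sum fun i _ => Finset.sum_le_sum_of_subset_of_nonneg
            (Finset.subset_univ _) fun j _ _ => ?_
          split_ifs <;> positivity
      _ ≤ ∑ _i : Fin p, ε ^ 2 * (T : ℝ) ^ (2 * α) * T := by
          refine Finset.sum_le_sum fun i _ => ?_
          rw [← Finset.mul_sum]
          refine mul_le_mul_of_nonneg_left ?_ (by positivity)
          have := card_block_le (p := p) (by omega : 1 ≤ T) (blockIdx p T i)
          rw [Fintype.card_subtype] at this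
          simp_rw [eq_comm (a := blockIdx p T i)]
          rw [Finset.sum_boole]
          exact_mod_cast this
      _ = p * (8 * φ ^ 2 * (T : ℝ) ^ (2 * α)) := by
          rw [Finset.sum_const, Finset.card_univ, Fintype.card_fin, nsmul_eq_mul, ← hε]
          ring
      _ ≤ p * L := by gcongr
  · have h1 : ∑ i : Fin p, ∑ j ∈ Finset.Ioi i, (1 + spike (blockIdx p T) ε w) i j ^ 2 =
        ε ^ 2 * ∑ i : Fin p, ∑ j ∈ Finset.Ioi i,
          if blockIdx p T i = blockIdx p T j then (1 : ℝ) else 0 := by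
      simp_rw [Finset.mul_sum]
      exact Finset.sum_congr rfl fun i _ => Finset.sum_congr rfl fun j hj =>
        one_add_spike_apply_sq _ _ _ (Finset.mem_Ioi.1 hj)
    have h2 := sq_card_le_card_mul_pairs (blockIdx p T)
    rw [pairs_eq, Fintype.card_fin, Fintype.card_fin] at h2
    rw [h1]
    set N := ∑ i : Fin p, ∑ j ∈ Finset.Ioi i,
          if blockIdx p T i = blockIdx p T j then (1 : ℝ) else 0
    have hN0 : 0 ≤ N := Finset.sum_nonneg fun i _ => Finset.sum_nonneg fun j _ => by
      split_ifs <;> norm_num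
    have hK : ((p / T + 1 : ℕ) : ℝ) * T ≤ 2 * p := by
      have : (p / T + 1) * T ≤ 2 * p := by
        rw [add_mul, one_mul]
        have := Nat.div_mul_le_self p T
        omega
      exact_mod_cast this
    have h3 : p * T ≤ 2 * (2 * N + p) := by
      have h4 : (p : ℝ) ^ 2 * T ≤ 2 * p * (2 * N + p) := by
        calc (p : ℝ) ^ 2 * T ≤ ((p / T + 1 : ℕ) : ℝ) * (2 * N + p) * T := by gcongr
          _ = ((p / T + 1 : ℕ) : ℝ) * T * (2 * N + p) := by ring
          _ ≤ 2 * p * (2 * N + p) := by gcongr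
      nlinarith
    have h5 : p * T / 8 ≤ N := by nlinarith
    rw [one_div, le_inv_mul_iff₀ hp0]
    calc (p : ℝ) * φ ^ 2 = ε ^ 2 * (p * T / 8) := by linear_combination (-(p : ℝ) / 8) * hε
      _ ≤ ε ^ 2 * N := by gcongr

/-! ### Minimax lower bound -/

/-- Non-asymptotic lower bound, with blocks of length `T` and `ε² = 8 φ² / T`. -/
lemma one_sub_le_minimaxError_classQ {n p T : ℕ} {α L φ δ : ℝ} (hα : 0 < α) (hT : 4 ≤ T)
    (hTp : T ≤ p) (hL : 8 * φ ^ 2 * (T : ℝ) ^ (2 * α) ≤ L) (hφT : 8 * φ ^ 2 * T ≤ 1 / 8)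
    (hδ0 : 0 < δ) (hδ1 : δ ≤ 1) (hn : 102400 * ((n : ℝ) ^ 2 * φ ^ 4 * p / T) ≤ δ ^ 2) :
    1 - δ ≤ minimaxError n p (classQ p α L φ) := by
  have hT4 : (4 : ℝ) ≤ T := by exact_mod_cast hT
  have hT0 : (0 : ℝ) < T := by linarith
  have hTp' : (T : ℝ) ≤ p := by exact_mod_cast hTp
  set ε := √(8 * φ ^ 2 / T) with hεdef
  have hε2 : ε ^ 2 = 8 * φ ^ 2 / T := Real.sq_sqrt (by positivity)
  have hε : ε ^ 2 * T = 8 * φ ^ 2 := by rw [hε2]; field_simp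
  have hεT : ε ^ 2 * T ^ 2 ≤ 1 / 8 := by
    rw [pow_two (T : ℝ), ← mul_assoc, hε]
    exact hφT
  have hcard := card_block_le (p := p) (by omega : 1 ≤ T)
  have hcontr := fun w => spike_contraction (b := blockIdx p T) (ε := ε) (T := T)
    (fun k => by simpa [Fintype.card_subtype] using hcard k) (by linarith) w
  have hpos := fun w => posDef_one_add (spike_isSymm (blockIdx p T) ε w) (hcontr w)
  have hnθ : (n : ℝ) * ε ^ 2 * T = 8 * (n * φ ^ 2) := by rw [mul_assoc, hε]; ring
  have hnφ : (n : ℝ) * φ ^ 2 ≤ 1 / 64 := by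
    have h1 : (n : ℝ) ^ 2 * φ ^ 4 ≤ (n : ℝ) ^ 2 * φ ^ 4 * p / T := by
      rw [le_div_iff₀ hT0]
      gcongr
    have h2 : ((n : ℝ) * φ ^ 2) ^ 2 ≤ (1 / 64) ^ 2 := by nlinarith
    exact (pow_le_pow_iff_left₀ (by positivity) (by norm_num) two_ne_zero).1 h2
  refine one_sub_le_minimaxError (fun w => spike (blockIdx p T) ε w)
    (fun w => one_add_spike_mem_classQ hα hT hTp hε hL w (hpos w)) hpos
    (fun u v => posDef_inv_add_inv_sub_one (spike_isSymm _ ε u) (hcontr u) (spike_isSymm _ ε v)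
      (hcontr v)) hδ0 ?_
  refine (average_inv_sqrt_det_pow_le hcard (by omega) hεT (by rw [hnθ]; linarith)).trans ?_
  rw [hnθ, Fintype.card_fin]
  set K : ℕ := p / T + 1
  have hK : (K : ℝ) ≤ 2 * (p / T) := by
    have : (K : ℝ) ≤ p / T + 1 := by
      simp only [K]
      push_cast
      gcongr
      exact Nat.cast_div_le
    have h1 : 1 ≤ (p : ℝ) / T := (one_le_div hT0).2 hTp'
    linarith
  set x := 400 * (8 * ((n : ℝ) * φ ^ 2)) ^ 2 with hx
  have hx0 : 0 ≤ x := by positivity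
  have hKx : 2 * (K * x) ≤ δ ^ 2 := by
    refine le_trans ?_ hn
    calc 2 * (K * x) ≤ 2 * (2 * (p / T) * x) := by gcongr
      _ = 102400 * ((n : ℝ) ^ 2 * φ ^ 4 * p / T) := by rw [hx]; ring
  have hKx0 : 0 ≤ K * x := by positivity
  have hKx1 : K * x ≤ 1 / 2 := by nlinarith
  calc (1 + x) ^ K ≤ Real.exp x ^ K := by
        gcongr
        rw [add_comm]
        exact Real.add_one_le_exp x
    _ = Real.exp (K * x) := (Real.exp_nat_mul x K).symm
    _ ≤ 1 / (1 - K * x) := Real.exp_bound_div_one_sub_of_interval hKx0 (by linarith)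
    _ ≤ 1 + δ ^ 2 := by
      rw [div_le_iff₀ (by linarith)]
      nlinarith

lemma constC_pos {α L : ℝ} (hα : 0 < α) (hL : 0 < L) : 0 < constC α L := by
  unfold constC
  positivity

lemma bFun_sq {α L φ : ℝ} (hα : 0 < α) (hL : 0 < L) (hφ : 0 < φ) :
    bFun α L φ ^ 2 = constC α L * φ ^ (4 + 1 / α) := by
  unfold bFun
  rw [mul_pow, ← Real.rpow_natCast, ← Real.rpow_mul (constC_pos hα hL).le, ← Real.rpow_natCast,
    ← Real.rpow_mul hφ.le]
  congr 1
  · norm_num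
  · congr 1
    field_simp
    push_cast
    ring

end CovTest

end

theorem theorem3 (α L : ℝ) (hL : 0 < L)
    (n p : ℕ → ℕ) (φ : ℕ → ℝ)
    (hn : Tendsto n atTop atTop) (hp : Tendsto p atTop atTop)
    (hφpos : ∀ k, 0 < φ k)
    (hα : 3 / 2 < α ∨
      (5 / 8 < α ∧
        Tendsto (fun k => (n k : ℝ) * (p k : ℝ) * φ k ^ (6 - 2 / α)) atTop (𝓝 0)))
    (hφ : Tendsto φ atTop (𝓝 0))
    (hpφ : Tendsto (fun k => (p k : ℝ) * φ k ^ (1 / α)) atTop atTop)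
    (hb : Tendsto (fun k => (n k : ℝ) ^ 2 * (p k : ℝ) * CovTest.bFun α L (φ k) ^ 2)
      atTop (𝓝 0)) :
    Tendsto (fun k => CovTest.minimaxError (n k) (p k) (CovTest.classQ (p k) α L (φ k)))
      atTop (𝓝 1) := by
  have hα2 : 1 / 2 < α := by
    rcases hα with h | h
    · linarith
    · linarith [h.1]
  have hα0 : 0 < α := by linarith
  have hC := CovTest.constC_pos hα0 hL
  set c := (L / 8) ^ (1 / (2 * α)) with hc
  have hc0 : 0 < c := by positivity
  -- `X k` is the real block length; its integer part satisfies the ellipsoid constraint.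
  set X : ℕ → ℝ := fun k => c * φ k ^ (-(1 / α)) with hX
  have hX0 : ∀ k, 0 < X k := fun k => mul_pos hc0 (Real.rpow_pos_of_pos (hφpos k) _)
  have hφ' : Tendsto φ atTop (𝓝[>] 0) :=
    tendsto_nhdsWithin_iff.2 ⟨hφ, Eventually.of_forall hφpos⟩
  have hXtop : Tendsto X atTop atTop := by
    refine Tendsto.const_mul_atTop hc0 ?_
    exact (tendsto_rpow_neg_nhdsGT_zero (by simpa using hα0)).comp hφ'
  have hXL : ∀ k, 8 * φ k ^ 2 * X k ^ (2 * α) = L := fun k => by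
    have hφk := hφpos k
    rw [hX]
    simp only
    rw [Real.mul_rpow hc0.le (by positivity), hc, ← Real.rpow_mul (by positivity),
      ← Real.rpow_mul hφk.le]
    have h1 : 1 / (2 * α) * (2 * α) = 1 := by field_simp
    have h2 : -(1 / α) * (2 * α) = -2 := by field_simp
    rw [h1, h2, Real.rpow_one, Real.rpow_neg hφk.le, Real.rpow_two]
    field_simp
  have hXφ : Tendsto (fun k => 8 * φ k ^ 2 * X k) atTop (𝓝 0) := by
    have h1 : ∀ k, 8 * φ k ^ 2 * X k = 8 * c * φ k ^ (2 - 1 / α) := fun k => by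
      rw [hX, sub_eq_add_neg, Real.rpow_add (hφpos k), Real.rpow_two]
      ring
    simp_rw [h1]
    have h2 : 0 < 2 - 1 / α := by
      rw [sub_pos, div_lt_iff₀ hα0]
      linarith
    have h3 := (hφ.rpow_const (p := 2 - 1 / α) (Or.inr h2.le)).const_mul (8 * c)
    rwa [Real.zero_rpow h2.ne', mul_zero] at h3
  have hXp : ∀ᶠ k in atTop, X k ≤ p k := by
    filter_upwards [hpφ.eventually_ge_atTop c] with k hk
    have hφk := Real.rpow_pos_of_pos (hφpos k) (1 / α)
    rw [hX]
    simp only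
    rw [Real.rpow_neg (hφpos k).le, ← div_eq_mul_inv, div_le_iff₀ hφk]
    exact hk
  have hchi : Tendsto (fun k => 102400 * (2 * ((n k : ℝ) ^ 2 * φ k ^ 4 * p k / X k)))
      atTop (𝓝 0) := by
    have h1 : ∀ k, 102400 * (2 * ((n k : ℝ) ^ 2 * φ k ^ 4 * p k / X k)) =
        204800 / (c * CovTest.constC α L) *
          ((n k : ℝ) ^ 2 * (p k : ℝ) * CovTest.bFun α L (φ k) ^ 2) := fun k => by
      have hφk := Real.rpow_pos_of_pos (hφpos k) (1 / α)
      have hXk : X k = c * (φ k ^ (1 / α))⁻¹ := by rw [← Real.rpow_neg (hφpos k).le]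
      rw [CovTest.bFun_sq hα0 hL (hφpos k), hXk, Real.rpow_add (hφpos k)]
      have : φ k ^ (4 : ℝ) = φ k ^ 4 := by exact_mod_cast Real.rpow_natCast (φ k) 4
      rw [this]
      field_simp
      ring
    simp_rw [h1]
    simpa using hb.const_mul (204800 / (c * CovTest.constC α L))
  refine tendsto_order.2 ⟨fun a ha => ?_, fun a ha =>
    Eventually.of_forall fun k => (CovTest.minimaxError_le_one _).trans_lt ha⟩
  set δ := min 1 ((1 - a) / 2) with hδ
  have hδ0 : 0 < δ := lt_min one_pos (by linarith)
  have hδ1 : δ ≤ 1 := min_le_left _ _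
  have hδa : δ ≤ (1 - a) / 2 := min_le_right _ _
  filter_upwards [hXtop.eventually_ge_atTop 4, hXp,
    hXφ.eventually_lt_const (by norm_num : (0 : ℝ) < 1 / 8),
    hchi.eventually_lt_const (by positivity : 0 < δ ^ 2)] with k h4 hXpk hXφk hchik
  have hTX : (⌊X k⌋₊ : ℝ) ≤ X k := Nat.floor_le (hX0 k).le
  have hXT : X k / 2 ≤ ⌊X k⌋₊ := by
    have := Nat.lt_floor_add_one (X k)
    linarith
  have hT4 : 4 ≤ ⌊X k⌋₊ := Nat.le_floor (by exact_mod_cast h4)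
  have hTp : ⌊X k⌋₊ ≤ p k := by exact_mod_cast hTX.trans hXpk
  refine lt_of_lt_of_le (by linarith : a < 1 - δ)
    (CovTest.one_sub_le_minimaxError_classQ hα0 hT4 hTp ?_ ?_ hδ0 hδ1 ?_)
  · rw [← hXL k]
    gcongr
  · refine le_trans ?_ hXφk.le
    gcongr
  · refine le_trans ?_ hchik.le
    have h5 : (n k : ℝ) ^ 2 * φ k ^ 4 * p k / ⌊X k⌋₊ ≤
        (n k : ℝ) ^ 2 * φ k ^ 4 * p k / (X k / 2) := by
      have := hX0 k
      gcongr
    have h6 : (n k : ℝ) ^ 2 * φ k ^ 4 * p k / (X k / 2) =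
        2 * ((n k : ℝ) ^ 2 * φ k ^ 4 * p k / X k) := by
      have := (hX0 k).ne'
      field_simp
    rw [h6] at h5
    linarith
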